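/- Let $n\ge 5$. Let $G=\mathrm{Gr}(3,n)$ be the complex Grassmannian of $3$-dimensional subspaces of $\mathbb{C}^n$, with Plücker coordinates $p_I$ ($I\subset[n]$, $|I|=3$). Let $G_{\ge 0}$ (resp. $G_{>0}$) be the set of real points of $G$ whose Plücker coordinates are, up to a common scalar, all nonnegative (resp. positive). Let $V=V(3,n)\subset G$ be the Zariski closure (with its reduced structure) of the image of the rational map $\mathrm{Gr}(2,n)\dashrightarrow\mathrm{Gr}(3,n)$ that sends the class of a $2\times n$ matrix with columns $(a_j,b_j)^T$ to the class of the $3\times n$ matrix with columns $(a_j^2,a_jb_j,b_j^2)^T$. For a family $(A_1,A_2,\dots)$ of subsets of $[n]$ let $Z(A_1,A_2,\dots)$ be the closed subscheme of $G$ defined by the vanishing of all $p_I$ with $I\subset A_i$ for some $i$, let $ZV(A_1,A_2,\dots)=Z(A_1,A_2,\dots)\cap V$ (scheme-theoretically), and write $Z(A|B)=Z(A,B)$ when $[n]=A\sqcup B$. The totally nonnegative part of a subscheme of $G$ is the intersection of its set of points with $G_{\ge0}$. A cyclic interval is a set of consecutive indices modulo $n$. Then the set $(G_{\ge 0}\setminus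 G_{>0})\cap V$ is the union of the following sets: (1) the totally nonnegative parts of $Z(A|B)$, where $A|B$ runs over the partitions of $[n]$ into two cyclic intervals with $|A|,|B|\ge 2$; (2) the totally nonnegative parts of $ZV(\{i,i+1,x\}: x\in[n])$ for $i\in[n]$, with indices modulo $n$, i.e. of $ZV(12x:x\in[n])$ and its cyclic rotations. Moreover, for every partition $A|B$ as in (1), $Z(A|B)\subset V$ as subschemes of $G$, and thus $Z(A|B)=ZV(A|B)$. -/

import Mathlib

noncomputable section

namespace ABCT

/-- The row space of a complex matrix with `n` columns. -/
def rowSpan {k n : ℕ} (M : Matrix (Fin k) (Fin n) ℂ) : Submodule ℂ (Fin n → ℂ) :=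
  Submodule.span ℂ (Set.range fun i => M i)

/-- The complex Grassmannian `Gr(k, n)` of `k`-dimensional subspaces of `ℂⁿ`. -/
def Gr (k n : ℕ) : Set (Submodule ℂ (Fin n → ℂ)) :=
  {W | Module.finrank ℂ W = k}

/-- The maximal minor `p_I` of a `3 × n` matrix, `I = {I 0 < I 1 < I 2}`. -/
def plucker {R : Type*} [CommRing R] {n : ℕ} (M : Matrix (Fin 3) (Fin n) R)
    (I : Fin 3 ↪o Fin n) : R :=
  (M.submatrix id I).det

/-- The polynomial `F` in the Plücker coordinates vanishes at `W`, i.e. at the Plücker vector of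
every matrix representing `W`. (For homogeneous `F` and `W ∈ Gr 3 n` it is the same to ask this
of one representing matrix: they all have the same Plücker vector up to a nonzero factor.) -/
def VanishesAt {n : ℕ} (F : MvPolynomial (Fin 3 ↪o Fin n) ℂ)
    (W : Submodule ℂ (Fin n → ℂ)) : Prop :=
  ∀ M : Matrix (Fin 3) (Fin n) ℂ, rowSpan M = W → MvPolynomial.eval (plucker M) F = 0

/-- The closure of a subset of `Gr(3, n)` in the Zariski topology, that is, the common zero locus
of the homogeneous polynomials in the Plücker coordinates that vanish on the subset. -/
def zariskiClosure {n : ℕ} (S : Set (Submodule ℂ (Fin n → ℂ))) :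
    Set (Submodule ℂ (Fin n → ℂ)) :=
  {W | W ∈ Gr 3 n ∧ ∀ (d : ℕ) (F : MvPolynomial (Fin 3 ↪o Fin n) ℂ), F.IsHomogeneous d →
    (∀ U ∈ S, VanishesAt F U) → VanishesAt F W}

/-- The column-wise Veronese map `(a, b) ↦ (a², ab, b²)` on `2 × n` matrices. -/
def veronese {n : ℕ} (M : Matrix (Fin 2) (Fin n) ℂ) : Matrix (Fin 3) (Fin n) ℂ :=
  Matrix.of ![fun j => M 0 j ^ 2, fun j => M 0 j * M 1 j, fun j => M 1 j ^ 2]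

/-- The image of the rational Veronese map `Gr(2, n) ⇢ Gr(3, n)`, which is defined at the points
`[M]` for which `veronese M` has rank `3`. -/
def veroneseImage (n : ℕ) : Set (Submodule ℂ (Fin n → ℂ)) :=
  {W | W ∈ Gr 3 n ∧ ∃ M : Matrix (Fin 2) (Fin n) ℂ, rowSpan M ∈ Gr 2 n ∧
    W = rowSpan (veronese M)}

/-- The ABCT variety `V(3, n)`. -/
def V (n : ℕ) : Set (Submodule ℂ (Fin n → ℂ)) :=
  zariskiClosure (veroneseImage n)

/-- The totally nonnegative Grassmannian `Gr_{≥0}(3, n)`. -/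
def GrNonneg (n : ℕ) : Set (Submodule ℂ (Fin n → ℂ)) :=
  {W | W ∈ Gr 3 n ∧ ∃ M : Matrix (Fin 3) (Fin n) ℝ,
    W = rowSpan (M.map Complex.ofReal) ∧ ∀ I, 0 ≤ plucker M I}

/-- The positive Grassmannian `Gr_{>0}(3, n)`. -/
def GrPos (n : ℕ) : Set (Submodule ℂ (Fin n → ℂ)) :=
  {W | W ∈ Gr 3 n ∧ ∃ M : Matrix (Fin 3) (Fin n) ℝ,
    W = rowSpan (M.map Complex.ofReal) ∧ ∀ I, 0 < plucker M I}

/-- The totally nonnegative part of a subset of `Gr(3, n)`. -/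
def nonnegPart {n : ℕ} (S : Set (Submodule ℂ (Fin n → ℂ))) :
    Set (Submodule ℂ (Fin n → ℂ)) :=
  S ∩ GrNonneg n

/-- The points of `Z(A₁, A₂, …)`: all `p_I` with `I ⊆ A` for some member `A` of the family
vanish. -/
def Z {n : ℕ} (𝒜 : Set (Finset (Fin n))) : Set (Submodule ℂ (Fin n → ℂ)) :=
  {W | W ∈ Gr 3 n ∧ ∀ A ∈ 𝒜, ∀ I : Fin 3 ↪o Fin n, (∀ k, I k ∈ A) →
    ∀ M : Matrix (Fin 3) (Fin n) ℂ, rowSpan M = W → plucker M I = 0}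

/-- The points of `ZV(A₁, A₂, …)`. -/
def ZV {n : ℕ} (𝒜 : Set (Finset (Fin n))) : Set (Submodule ℂ (Fin n → ℂ)) :=
  Z 𝒜 ∩ V n

/-! ### Scheme structures

A closed subscheme of `Gr(3, n)` is described by its ideals in the coordinate rings of the standard
affine charts `{p_J ≠ 0}`. Each chart is an affine space of dimension `3(n - 3)`. -/

/-- The coordinate ring of the chart `{p_J ≠ 0}` of `Gr(3, n)`. -/
abbrev ChartRing {n : ℕ} (J : Fin 3 ↪o Fin n) : Type :=
  MvPolynomial (Fin 3 × {j : Fin n // j ∉ Set.range J}) ℂ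

open Classical in
/-- The universal matrix over the chart `{p_J ≠ 0}`: the identity matrix in the columns `J`,
and indeterminates in the other columns. -/
def chartMatrix {n : ℕ} (J : Fin 3 ↪o Fin n) : Matrix (Fin 3) (Fin n) (ChartRing J) :=
  Matrix.of fun i j =>
    if h : j ∉ Set.range J then MvPolynomial.X (i, ⟨j, h⟩) else if j = J i then 1 else 0

/-- The point of the chart `{p_J ≠ 0}` with coordinates `x`. -/
def chartPoint {n : ℕ} (J : Fin 3 ↪o Fin n)
    (x : Fin 3 × {j : Fin n // j ∉ Set.range J} → ℂ) : Submodule ℂ (Fin n → ℂ) :=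
  rowSpan ((chartMatrix J).map (MvPolynomial.eval x))

/-- The ideal of the scheme `Z(A₁, A₂, …)` in the chart `{p_J ≠ 0}`, generated by the `p_I`. -/
def idealZ {n : ℕ} (𝒜 : Set (Finset (Fin n))) (J : Fin 3 ↪o Fin n) : Ideal (ChartRing J) :=
  Ideal.span {f | ∃ A ∈ 𝒜, ∃ I : Fin 3 ↪o Fin n, (∀ k, I k ∈ A) ∧ f = plucker (chartMatrix J) I}

/-- The ideal of the (reduced) variety `V(3, n)` in the chart `{p_J ≠ 0}`. -/
def idealV {n : ℕ} (J : Fin 3 ↪o Fin n) : Ideal (ChartRing J) :=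
  MvPolynomial.vanishingIdeal ℂ {x | chartPoint J x ∈ V n}

/-- The ideal of the scheme-theoretic intersection `ZV(A₁, A₂, …)` in the chart `{p_J ≠ 0}`. -/
def idealZV {n : ℕ} (𝒜 : Set (Finset (Fin n))) (J : Fin 3 ↪o Fin n) : Ideal (ChartRing J) :=
  idealZ 𝒜 J ⊔ idealV J

/-! ### The two families -/

/-- Cyclic intervals `{i, i + 1, …, i + m - 1}` modulo `n`. -/
def IsCyclicInterval {n : ℕ} (A : Finset (Fin n)) : Prop :=
  ∃ (i : Fin n) (m : ℕ), A = (Finset.range m).image fun k => (finRotate n ^ k) i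

/-- `A | B` is a partition of `[n]` into two cyclic intervals of size at least `2`. -/
def IsCyclicPartition {n : ℕ} (A B : Finset (Fin n)) : Prop :=
  IsCyclicInterval A ∧ IsCyclicInterval B ∧ Disjoint A B ∧ A ∪ B = Finset.univ ∧
    2 ≤ A.card ∧ 2 ≤ B.card

/-- The family `{i, i + 1, x}`, `x ∈ [n]`: the rotation of the family `12x`, `x ∈ [n]`, that
takes `1` to `i`. -/
def collidingFamily {n : ℕ} (i : Fin n) : Set (Finset (Fin n)) :=
  {A | ∃ x : Fin n, A = {i, finRotate n i, x}}

end ABCT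

end

noncomputable section

namespace ABCT

/-! Columns are read as vectors in 3-space, that is, as points of the projective plane where
nonzero. A Veronese matrix has all its columns on one smooth conic, so points of `V n` satisfy the
quartic bracket relation for six points on a conic (`conic_identity_of_mem_V`).

A pair of lines is a limit of smooth conics: xy = (sz)² tends to xy = 0. Points split between two
lines can follow this degeneration, which gives Z(A|B) ⊆ V (`Z_subset_V`). For the scheme statement,
in a chart meeting Z(A|B) the ideal of Z(A|B) contains certain variables and the 2 × 2 minors of two
rows of variables. These elements generate the kernel of a Segre-type parametrization by points of
Z(A|B). A polynomial vanishing on V pulls back to zero, hence lies in that ideal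
(`idealV_le_idealZ`).

For a nonnegative boundary point, either two cyclically adjacent columns are parallel, which is the
second family, or the columns form an `IsCyclicConfig`. In the latter case Plücker relations and
positivity turn one vanishing minor into a vanishing consecutive minor (`exists_consecutive`). A
conic with three distinct collinear points contains their line, so the points off this line are
collinear too, and positivity makes each of the two groups an arc
(`exists_two_arcs_of_consecutive`). If the outer two of the three points coincide, signs alone put
the remaining points on a line.

Conversely, each family contains a set of at least three indices, so some Plücker coordinate
vanishes. -/

/-! ### Row spaces, minors and Plücker coordinates -/

theorem rowSpan_mem_Gr {k n : ℕ} {M : Matrix (Fin k) (Fin n) ℂ} :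
    rowSpan M ∈ Gr k n ↔ M.rank = k := by
  have : rowSpan M = Submodule.span ℂ (Set.range M.row) := rfl
  rw [Gr, Set.mem_ofPred_eq, this, ← Matrix.rank_eq_finrank_span_row]

theorem rank_eq_of_det_ne_zero {K : Type*} [Field K] {k : ℕ} {ι : Type*} [Fintype ι]
    {M : Matrix (Fin k) ι K} {f : Fin k → ι} (h : (M.submatrix id f).det ≠ 0) : M.rank = k := by
  refine le_antisymm (by simpa using M.rank_le_card_height) ?_
  have h1 := Matrix.rank_submatrix_le M id f
  rw [Matrix.rank_of_det_ne_zero h] at h1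
  simpa using h1

theorem exists_det_ne_zero {K : Type*} [Field K] {k : ℕ} {ι : Type*} [Fintype ι]
    {M : Matrix (Fin k) ι K} (h : M.rank = k) : ∃ f : Fin k → ι, (M.submatrix id f).det ≠ 0 := by
  obtain ⟨κ, a, ha, hspan, hli⟩ := exists_linearIndependent' K M.col
  have : Fintype κ := Fintype.ofInjective a ha
  have hc : Fintype.card κ = k := by
    rw [← h, Matrix.rank_eq_finrank_span_cols, ← hspan]
    exact (finrank_span_eq_card hli).symm
  let e : Fin k ≃ κ := (Fintype.equivFinOfCardEq hc).symm
  refine ⟨a ∘ e, fun h0 => ?_⟩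
  have hli' : LinearIndependent K ((M.submatrix id (a ∘ e)).col) :=
    hli.comp e e.injective
  rw [Matrix.linearIndependent_cols_iff_isUnit, Matrix.isUnit_iff_isUnit_det, h0] at hli'
  simp at hli'

theorem exists_rowSpan_eq {k n : ℕ} {W : Submodule ℂ (Fin n → ℂ)} (h : W ∈ Gr k n) :
    ∃ M : Matrix (Fin k) (Fin n) ℂ, rowSpan M = W := by
  let b := Module.finBasisOfFinrankEq ℂ W h
  refine ⟨fun i => (b i : Fin n → ℂ), ?_⟩
  have h1 := congrArg (Submodule.map W.subtype) b.span_eq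
  rw [Submodule.map_span, ← Set.range_comp, Submodule.map_top, Submodule.range_subtype] at h1
  exact h1

theorem exists_mul_eq {k l n : ℕ} {M : Matrix (Fin k) (Fin n) ℂ} {M' : Matrix (Fin l) (Fin n) ℂ}
    (h : rowSpan M' ≤ rowSpan M) : ∃ g : Matrix (Fin l) (Fin k) ℂ, M' = g * M := by
  have h1 : ∀ i, ∃ c : Fin k → ℂ, ∑ j, c j • M j = M' i := fun i =>
    (Submodule.mem_span_range_iff_exists_fun ℂ).1 (h (Submodule.subset_span ⟨i, rfl⟩))
  choose c hc using h1
  refine ⟨Matrix.of c, ?_⟩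
  ext i j
  have := congrFun (hc i) j
  rw [Finset.sum_apply] at this
  rw [Matrix.mul_apply]
  exact this.symm

theorem rowSpan_mul_le {k l n : ℕ} (g : Matrix (Fin l) (Fin k) ℂ) (M : Matrix (Fin k) (Fin n) ℂ) :
    rowSpan (g * M) ≤ rowSpan M := by
  refine Submodule.span_le.2 ?_
  rintro _ ⟨i, rfl⟩
  refine (Submodule.mem_span_range_iff_exists_fun ℂ).2 ⟨g i, ?_⟩
  ext j
  rw [Finset.sum_apply]
  exact (Matrix.mul_apply (M := g) (N := M)).symm

theorem rowSpan_mul {k n : ℕ} {g : Matrix (Fin k) (Fin k) ℂ} (hg : IsUnit g.det)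
    (M : Matrix (Fin k) (Fin n) ℂ) : rowSpan (g * M) = rowSpan M := by
  refine le_antisymm (rowSpan_mul_le g M) ?_
  conv_lhs => rw [← Matrix.nonsing_inv_mul_cancel_left (B := M) g hg]
  exact rowSpan_mul_le _ _

/-- The minor of a `3 × n` matrix on any three columns, in any order. -/
def minor {R : Type*} [CommRing R] {n : ℕ} (M : Matrix (Fin 3) (Fin n) R) (f : Fin 3 → Fin n) : R :=
  (M.submatrix id f).det

theorem plucker_eq_minor {R : Type*} [CommRing R] {n : ℕ} (M : Matrix (Fin 3) (Fin n) R)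
    (I : Fin 3 ↪o Fin n) : plucker M I = minor M I := rfl

theorem minor_mul {R : Type*} [CommRing R] {n : ℕ} (g : Matrix (Fin 3) (Fin 3) R)
    (M : Matrix (Fin 3) (Fin n) R) (f : Fin 3 → Fin n) : minor (g * M) f = g.det * minor M f := by
  rw [minor, minor, ← Matrix.det_mul]; rfl

theorem minor_map {R S : Type*} [CommRing R] [CommRing S] (φ : R →+* S) {n : ℕ}
    (M : Matrix (Fin 3) (Fin n) R) (f : Fin 3 → Fin n) : minor (M.map φ) f = φ (minor M f) := by
  rw [minor, minor, RingHom.map_det]; rfl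

theorem minor_eq_zero_of_not_injective {R : Type*} [CommRing R] {n : ℕ}
    (M : Matrix (Fin 3) (Fin n) R) {f : Fin 3 → Fin n} (hf : ¬ Function.Injective f) :
    minor M f = 0 := by
  rw [Function.Injective] at hf
  push Not at hf
  obtain ⟨i, j, hij, hne⟩ := hf
  exact Matrix.det_zero_of_column_eq hne fun k => by simp [hij]

theorem exists_sorted {n : ℕ} {f : Fin 3 → Fin n} (hf : Function.Injective f) :
    ∃ (I : Fin 3 ↪o Fin n) (σ : Equiv.Perm (Fin 3)), f = I ∘ σ := by
  have hs : StrictMono (f ∘ Tuple.sort f) :=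
    (Tuple.monotone_sort f).strictMono_of_injective (hf.comp (Tuple.sort f).injective)
  refine ⟨OrderEmbedding.ofStrictMono _ hs, (Tuple.sort f)⁻¹, ?_⟩
  ext k
  simp

theorem minor_comp_perm {R : Type*} [CommRing R] {n : ℕ} (M : Matrix (Fin 3) (Fin n) R)
    (f : Fin 3 → Fin n) (σ : Equiv.Perm (Fin 3)) :
    minor M (f ∘ σ) = (Equiv.Perm.sign σ : ℤ) * minor M f :=
  Matrix.det_permute' σ (M.submatrix id f)

theorem minor_comp_eq_zero {R : Type*} [CommRing R] {n : ℕ} {M : Matrix (Fin 3) (Fin n) R}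
    {f : Fin 3 → Fin n} (hf : minor M f = 0) (h : Fin 3 → Fin 3) : minor M (f ∘ h) = 0 := by
  by_cases hh : Function.Injective h
  · have := minor_comp_perm M f (Equiv.ofBijective h (Finite.injective_iff_bijective.1 hh))
    rwa [hf, mul_zero] at this
  · exact minor_eq_zero_of_not_injective M fun h' => hh h'.of_comp

/-- A minor, up to the order of its columns, is a linear form in the Plücker coordinates. -/
theorem exists_linear_form {n : ℕ} (f : Fin 3 → Fin n) :
    ∃ L : MvPolynomial (Fin 3 ↪o Fin n) ℂ, L.IsHomogeneous 1 ∧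
      ∀ M : Matrix (Fin 3) (Fin n) ℂ, MvPolynomial.eval (plucker M) L = minor M f := by
  by_cases hf : Function.Injective f
  · obtain ⟨I, σ, rfl⟩ := exists_sorted hf
    refine ⟨MvPolynomial.C ((Equiv.Perm.sign σ : ℤ) : ℂ) * MvPolynomial.X I,
      zero_add 1 ▸ (MvPolynomial.isHomogeneous_C _ _).mul (MvPolynomial.isHomogeneous_X ℂ I),
      fun M => ?_⟩
    rw [minor_comp_perm, map_mul, MvPolynomial.eval_C, MvPolynomial.eval_X, plucker_eq_minor]
  · exact ⟨0, MvPolynomial.isHomogeneous_zero _ _ _, fun M => by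
      rw [minor_eq_zero_of_not_injective M hf, map_zero]⟩

theorem eval_smul_of_isHomogeneous {σ : Type*} {d : ℕ} {F : MvPolynomial σ ℂ}
    (hF : F.IsHomogeneous d) (c : ℂ) (p : σ → ℂ) :
    MvPolynomial.eval (fun i => c * p i) F = c ^ d * MvPolynomial.eval p F := by
  rw [MvPolynomial.eval_eq, MvPolynomial.eval_eq, Finset.mul_sum]
  refine Finset.sum_congr rfl fun m hm => ?_
  have : ∑ i ∈ m.support, m i = d := by
    have := hF (MvPolynomial.mem_support_iff.1 hm)
    rwa [Finsupp.weight_apply, Finsupp.sum, Finset.sum_congr rfl fun i _ => by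
      rw [Pi.one_apply, smul_eq_mul, mul_one]] at this
  simp_rw [mul_pow, Finset.prod_mul_distrib, Finset.prod_pow_eq_pow_sum, this]
  ring

/-- Two representing matrices differ by a square factor `g`, which multiplies the Plücker vector by
`g.det`; a form of degree `d` only picks up the `d`-th power. -/
theorem vanishesAt_rowSpan {n d : ℕ} {F : MvPolynomial (Fin 3 ↪o Fin n) ℂ} (hF : F.IsHomogeneous d)
    {M : Matrix (Fin 3) (Fin n) ℂ} (h : MvPolynomial.eval (plucker M) F = 0) :
    VanishesAt F (rowSpan M) := by
  intro M' hM'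
  obtain ⟨g, rfl⟩ := exists_mul_eq hM'.le
  have : plucker (g * M) = fun I => g.det * plucker M I := funext fun I => minor_mul g M I
  rw [this, eval_smul_of_isHomogeneous hF, h, mul_zero]

theorem mem_Z_rowSpan {n : ℕ} {𝒜 : Set (Finset (Fin n))} {M : Matrix (Fin 3) (Fin n) ℂ}
    (hM : rowSpan M ∈ Gr 3 n) :
    rowSpan M ∈ Z 𝒜 ↔ ∀ A ∈ 𝒜, ∀ f : Fin 3 → Fin n, (∀ k, f k ∈ A) → minor M f = 0 := by
  constructor
  · intro h A hA f hf
    by_cases hi : Function.Injective f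
    · obtain ⟨I, σ, rfl⟩ := exists_sorted hi
      rw [minor_comp_perm, ← plucker_eq_minor, h.2 A hA I (fun k => ?_) M rfl, mul_zero]
      simpa using hf (σ⁻¹ k)
    · exact minor_eq_zero_of_not_injective M hi
  · intro h
    refine ⟨hM, fun A hA I hI M' hM' => ?_⟩
    obtain ⟨g, rfl⟩ := exists_mul_eq hM'.le
    rw [plucker_eq_minor, minor_mul, h A hA I hI, mul_zero]

/-! ### Degenerating smooth conics to pairs of lines -/

theorem exists_sq_eq_mul_eq {X Y Z : ℂ} (h : X * Z = Y ^ 2) :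
    ∃ α β : ℂ, α ^ 2 = X ∧ α * β = Y ∧ β ^ 2 = Z := by
  obtain ⟨α, hα⟩ := IsAlgClosed.exists_pow_nat_eq X two_pos
  by_cases h0 : α = 0
  · obtain ⟨β, hβ⟩ := IsAlgClosed.exists_pow_nat_eq Z two_pos
    refine ⟨α, β, hα, ?_, hβ⟩
    subst h0
    have : Y ^ 2 = 0 := by rw [← h, ← hα]; ring
    rw [pow_eq_zero_iff two_ne_zero] at this
    rw [this, zero_mul]
  · refine ⟨α, Y / α, hα, by field_simp, ?_⟩
    rw [div_pow, ← h, hα, mul_div_cancel_left₀]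
    rw [← hα]
    exact pow_ne_zero 2 h0

/-- The homogeneous Vandermonde determinant. -/
theorem minor_veronese {n : ℕ} (M : Matrix (Fin 2) (Fin n) ℂ) (f : Fin 3 → Fin n) :
    minor (veronese M) f =
      (M 0 (f 0) * M 1 (f 1) - M 0 (f 1) * M 1 (f 0)) *
      (M 0 (f 0) * M 1 (f 2) - M 0 (f 2) * M 1 (f 0)) *
      (M 0 (f 1) * M 1 (f 2) - M 0 (f 2) * M 1 (f 1)) := by
  simp only [minor, veronese, Matrix.det_fin_three, Matrix.submatrix_apply, id, Matrix.of_apply,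
    Matrix.cons_val]
  ring

/-- A linear change of coordinates takes this conic to the standard one, whose points are squares of
parameters. The nonzero minor gives rank 3 and, through its Vandermonde factors, rank 2 of the
matrix of parameters. -/
theorem mem_veroneseImage_of_conic {n : ℕ} {N : Matrix (Fin 3) (Fin n) ℂ} {c : ℂ} (hc : c ≠ 0)
    (h : ∀ j, N 0 j * N 1 j = (c * N 2 j) ^ 2) {f : Fin 3 → Fin n} (hf : minor N f ≠ 0) :
    rowSpan N ∈ veroneseImage n := by
  choose α β h1 h2 h3 using fun j => exists_sq_eq_mul_eq (h j)
  let M : Matrix (Fin 2) (Fin n) ℂ := Matrix.of ![α, β]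
  let g : Matrix (Fin 3) (Fin 3) ℂ := !![1, 0, 0; 0, 0, 1; 0, c⁻¹, 0]
  have hg : IsUnit g.det := by
    simp [g, Matrix.det_fin_three, hc]
  have hN : N = g * veronese M := by
    ext i j
    fin_cases i <;>
      simp [g, M, veronese, Matrix.mul_apply, Fin.sum_univ_three, h1, h2, h3, hc]
  refine ⟨rowSpan_mem_Gr.2 (rank_eq_of_det_ne_zero hf), M, ?_, by rw [hN, rowSpan_mul hg]⟩
  rw [hN, minor_mul, minor_veronese] at hf
  refine rowSpan_mem_Gr.2 (rank_eq_of_det_ne_zero (f := ![f 0, f 1]) ?_)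
  have := left_ne_zero_of_mul (left_ne_zero_of_mul (right_ne_zero_of_mul hf))
  simpa [Matrix.det_fin_two] using this

theorem continuous_minor {n : ℕ} {N : ℂ → Matrix (Fin 3) (Fin n) ℂ} (hN : Continuous N)
    (f : Fin 3 → Fin n) : Continuous fun s => minor (N s) f :=
  (hN.matrix_submatrix id f).matrix_det

/-- A limit in the classical topology suffices: a form vanishing on the Veronese image vanishes at
`N s` for small `s ≠ 0`, where the chosen minor is still nonzero, hence at `N 0` by continuity. At
`s = 0` the conic has become a pair of lines. -/
theorem mem_V_of_continuous {n : ℕ} {N : ℂ → Matrix (Fin 3) (Fin n) ℂ} (hN : Continuous N)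
    (h : ∀ s ≠ 0, ∀ j, N s 0 j * N s 1 j = (s * N s 2 j) ^ 2) {f : Fin 3 → Fin n}
    (hf : minor (N 0) f ≠ 0) : rowSpan (N 0) ∈ V n := by
  refine ⟨rowSpan_mem_Gr.2 (rank_eq_of_det_ne_zero hf), fun d F hF hV => vanishesAt_rowSpan hF ?_⟩
  have hcont : Continuous fun s => MvPolynomial.eval (plucker (N s)) F :=
    (MvPolynomial.continuous_eval F).comp (continuous_pi fun I => continuous_minor hN I)
  have hev : ∀ᶠ s in nhdsWithin (0 : ℂ) {0}ᶜ, MvPolynomial.eval (plucker (N s)) F = 0 := by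
    filter_upwards [self_mem_nhdsWithin, nhdsWithin_le_nhds
      ((continuous_minor hN f).continuousAt.eventually_ne hf)] with s hs hfs
    exact hV _ (mem_veroneseImage_of_conic hs (h s hs) hfs) _ rfl
  exact tendsto_nhds_unique (hcont.continuousAt.tendsto.mono_left nhdsWithin_le_nhds)
    (tendsto_const_nhds.congr' (hev.mono fun s hs => hs.symm))

/-- A family of points whose `3 × 3` minors all vanish lies in a plane. -/
theorem exists_dual_of_minor_eq_zero {n : ℕ} {M : Matrix (Fin 3) (Fin n) ℂ} {A : Finset (Fin n)}
    (h : ∀ f : Fin 3 → Fin n, (∀ k, f k ∈ A) → minor M f = 0) :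
    ∃ l : Fin 3 → ℂ, l ≠ 0 ∧ ∀ a ∈ A, ∑ i, l i * M i a = 0 := by
  let MA : Matrix (Fin 3) A ℂ := M.submatrix id Subtype.val
  have hlt : Submodule.span ℂ (Set.range MA.col) < ⊤ := by
    refine lt_top_iff_ne_top.2 fun htop => ?_
    have hr : MA.rank = 3 := by
      rw [Matrix.rank_eq_finrank_span_cols, htop, finrank_top, Module.finrank_fin_fun]
    obtain ⟨f, hf⟩ := exists_det_ne_zero hr
    exact hf (h (fun k => f k) fun k => (f k).2)
  obtain ⟨φ, hφ, hle⟩ := Submodule.exists_le_ker_of_lt_top _ hlt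
  have key : ∀ x : Fin 3 → ℂ, φ x = ∑ i, φ (Pi.single i 1) * x i := fun x => by
    conv_lhs => rw [pi_eq_sum_univ' x, map_sum]
    refine Finset.sum_congr rfl fun i _ => ?_
    rw [map_smul, smul_eq_mul, mul_comm]
  refine ⟨fun i => φ (Pi.single i 1), fun h0 => hφ ?_, fun a ha => ?_⟩
  · ext i
    simpa using congrFun h0 i
  · rw [← key fun i => M i a]
    exact hle (Submodule.subset_span ⟨⟨a, ha⟩, rfl⟩)

theorem exists_isUnit_det_of_linearIndependent {l₁ l₂ : Fin 3 → ℂ}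
    (h : LinearIndependent ℂ ![l₁, l₂]) :
    ∃ g : Matrix (Fin 3) (Fin 3) ℂ, IsUnit g.det ∧ g 0 = l₁ ∧ g 1 = l₂ := by
  have hlt : Submodule.span ℂ (Set.range ![l₁, l₂]) < ⊤ := by
    refine lt_top_iff_ne_top.2 fun htop => ?_
    have := finrank_span_eq_card h
    rw [htop, finrank_top] at this
    simp at this
  obtain ⟨l₃, -, hl₃⟩ := SetLike.exists_of_lt hlt
  have hli : LinearIndependent ℂ (Fin.snoc ![l₁, l₂] l₃ : Fin 3 → Fin 3 → ℂ) :=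
    linearIndependent_finSnoc.2 ⟨h, hl₃⟩
  refine ⟨Matrix.of (Fin.snoc ![l₁, l₂] l₃ : Fin 3 → Fin 3 → ℂ), ?_, ?_, ?_⟩
  · rw [← Matrix.isUnit_iff_isUnit_det, ← Matrix.linearIndependent_rows_iff_isUnit]
    exact hli
  · rfl
  · rfl

open Classical in
/-- A conic degeneration: the points in `A` move to the line `x = 0`, the others to `y = 0`. -/
def conicFamily {n : ℕ} (N : Matrix (Fin 3) (Fin n) ℂ) (A : Finset (Fin n)) (s : ℂ) :
    Matrix (Fin 3) (Fin n) ℂ :=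
  Matrix.of
    ![fun j => if j ∈ A then if N 1 j = 0 then s * N 2 j else s ^ 2 * N 2 j ^ 2 / N 1 j
        else if N 0 j = 0 then s * N 2 j else N 0 j,
      fun j => if j ∈ A then if N 1 j = 0 then s * N 2 j else N 1 j
        else if N 0 j = 0 then s * N 2 j else s ^ 2 * N 2 j ^ 2 / N 0 j,
      fun j => N 2 j]

theorem Z_subset_V {n : ℕ} {A B : Finset (Fin n)} (hAB : A ∪ B = Finset.univ) :
    Z {A, B} ⊆ V n := by
  intro W hW
  obtain ⟨M, rfl⟩ := exists_rowSpan_eq hW.1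
  have hminor := (mem_Z_rowSpan hW.1).1 hW
  obtain ⟨l₁, h1, hA⟩ := exists_dual_of_minor_eq_zero (hminor A (by simp))
  obtain ⟨l₂, h2, hB⟩ := exists_dual_of_minor_eq_zero (hminor B (by simp))
  obtain ⟨f, hf⟩ := exists_det_ne_zero (rowSpan_mem_Gr.1 hW.1)
  -- Were the two functionals proportional, all columns would lie in one plane, against the nonzero
  -- minor `f`.
  have hli : LinearIndependent ℂ ![l₁, l₂] := by
    rw [LinearIndependent.pair_iff' h1]
    rintro c rfl
    have hc : c ≠ 0 := by rintro rfl; simp at h2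
    refine h1 (Matrix.eq_zero_of_vecMul_eq_zero hf ?_)
    ext k
    have hk := Finset.mem_union.1 (hAB ▸ Finset.mem_univ (f k))
    change ∑ i, l₁ i * M i (f k) = 0
    rcases hk with hk | hk
    · exact hA _ hk
    · have := hB _ hk
      simp only [Pi.smul_apply, smul_eq_mul, mul_assoc, ← Finset.mul_sum] at this
      exact (mul_eq_zero.1 this).resolve_left hc
  obtain ⟨g, hg, hg0, hg1⟩ := exists_isUnit_det_of_linearIndependent hli
  have hNA : ∀ j ∈ A, (g * M) 0 j = 0 := fun j hj => by
    rw [Matrix.mul_apply, hg0, hA j hj]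
  have hNB : ∀ j ∉ A, (g * M) 1 j = 0 := fun j hj => by
    rw [Matrix.mul_apply, hg1]
    exact hB j ((Finset.mem_union.1 (hAB ▸ Finset.mem_univ j)).resolve_left hj)
  -- After the change of coordinates the lines are x = 0 and y = 0. The family solves xy = (sz)² for
  -- the coordinate that vanishes in the limit; if the other one vanishes too, both are set to sz.
  have h0 : conicFamily (g * M) A 0 = g * M := by
    ext i j
    by_cases hj : j ∈ A
    · have := hNA j hj
      fin_cases i <;> simp [conicFamily, hj, this]
      exact fun h => h.symm
    · have := hNB j hj
      fin_cases i <;> simp [conicFamily, hj, this]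
      exact fun h => h.symm
  rw [← rowSpan_mul hg, ← h0]
  refine mem_V_of_continuous (f := f) ?_ (fun s _ j => ?_) ?_
  · refine continuous_matrix fun i j => ?_
    fin_cases i <;> simp only [conicFamily, Matrix.of_apply] <;> simp <;> (try split_ifs) <;> fun_prop
  · simp only [conicFamily, Matrix.of_apply, Matrix.cons_val]
    split_ifs <;> field_simp
  · rw [h0, minor_mul]
    exact mul_ne_zero hg.ne_zero hf

/-! ### The relation for six points on a conic -/

/-- By the Vandermonde formula both sides are the product of the same twelve 2 × 2 minors, one for
each pair of indices other than af, be, cd. -/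
theorem conic_identity {n : ℕ} (M : Matrix (Fin 2) (Fin n) ℂ) (a b c d e f : Fin n) :
    minor (veronese M) ![a, b, c] * minor (veronese M) ![a, d, e] *
      minor (veronese M) ![b, d, f] * minor (veronese M) ![c, e, f] =
    minor (veronese M) ![a, b, d] * minor (veronese M) ![a, c, e] *
      minor (veronese M) ![b, c, f] * minor (veronese M) ![d, e, f] := by
  simp only [minor_veronese, Matrix.cons_val]
  ring

theorem conic_identity_of_mem_V {n : ℕ} {M : Matrix (Fin 3) (Fin n) ℂ} (hM : rowSpan M ∈ V n)
    (a b c d e f : Fin n) :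
    minor M ![a, b, c] * minor M ![a, d, e] * minor M ![b, d, f] * minor M ![c, e, f] =
    minor M ![a, b, d] * minor M ![a, c, e] * minor M ![b, c, f] * minor M ![d, e, f] := by
  choose L hL hev using exists_linear_form (n := n)
  have := hM.2 4 (L ![a, b, c] * L ![a, d, e] * L ![b, d, f] * L ![c, e, f] -
    L ![a, b, d] * L ![a, c, e] * L ![b, c, f] * L ![d, e, f])
    (((((hL _).mul (hL _)).mul (hL _)).mul (hL _)).sub
      ((((hL _).mul (hL _)).mul (hL _)).mul (hL _))) ?_ M rfl
  · simpa only [map_sub, map_mul, hev, sub_eq_zero] using this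
  · rintro _ ⟨-, N, -, rfl⟩ M' hM'
    obtain ⟨g, rfl⟩ := exists_mul_eq hM'.le
    simp only [map_sub, map_mul, hev, minor_mul]
    linear_combination g.det ^ 4 * conic_identity N a b c d e f

/-! ### The ideal of a generic `2 × m` matrix of rank at most one -/

section Segre

variable {Q ι : Type*} [CommRing Q]

/-- The product of the `x b` over the first `s` letters `b` of a word of length `s + t` and the
`y b` over the other letters; zero for words of other lengths. -/
def wordProd (x y : ι → Q) : ℕ → ℕ → List ι → Q
  | 0, 0, [] => 1
  | _ + 1, _, [] => 0
  | 0, _ + 1, [] => 0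
  | s + 1, t, b :: l => x b * wordProd x y s t l
  | 0, t + 1, b :: l => y b * wordProd x y 0 t l
  | 0, 0, _ :: _ => 0

/-- Modulo the relations only the number of letters carrying `x` matters, not which ones, so the
first letter may carry a `y`. -/
theorem wordProd_succ_right {x y : ι → Q} (h : ∀ b c, x b * y c = x c * y b) (b : ι) :
    ∀ (s t : ℕ) (l : List ι), wordProd x y s (t + 1) (b :: l) = y b * wordProd x y s t l
  | 0, t, l => rfl
  | s + 1, t, [] => by cases s <;> simp [wordProd]
  | s + 1, t, c :: l => by
    rw [wordProd, wordProd_succ_right h c s t l, wordProd]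
    linear_combination wordProd x y s t l * h b c

theorem wordProd_perm {x y : ι → Q} (h : ∀ b c, x b * y c = x c * y b) {l l' : List ι}
    (hl : l.Perm l') : ∀ s t, wordProd x y s t l = wordProd x y s t l' := by
  induction hl with
  | nil => exact fun _ _ => rfl
  | cons b _ ih =>
    rintro (_ | s) (_ | t) <;> simp [wordProd, ih]
  | swap b c l =>
    rintro (_ | _ | s) t
    · rcases t with _ | _ | t <;> simp [wordProd, mul_left_comm (y b)]
    · rcases t with _ | t
      · simp [wordProd]
      · simp only [wordProd]
        linear_combination wordProd x y 0 t l * h c b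
    · simp only [wordProd]
      ring
  | trans _ _ ih ih' => exact fun s t => (ih s t).trans (ih' s t)

/-- `wordProd` as a function of the multiset of the letters. -/
def multisetProd {x y : ι → Q} (h : ∀ b c, x b * y c = x c * y b) (s t : ℕ) (m : Multiset ι) : Q :=
  Quot.liftOn m (wordProd x y s t) fun _ _ hl => wordProd_perm h hl s t

theorem multisetProd_succ_left {x y : ι → Q} (h : ∀ b c, x b * y c = x c * y b) (s t : ℕ) (b : ι)
    (m : Multiset ι) : multisetProd h (s + 1) t (b ::ₘ m) = x b * multisetProd h s t m :=
  Quot.inductionOn m fun l => by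
    change wordProd x y (s + 1) t (b :: l) = _
    rw [wordProd]
    rfl

theorem multisetProd_succ_right {x y : ι → Q} (h : ∀ b c, x b * y c = x c * y b) (s t : ℕ) (b : ι)
    (m : Multiset ι) : multisetProd h s (t + 1) (b ::ₘ m) = y b * multisetProd h s t m :=
  Quot.inductionOn m fun l => wordProd_succ_right h b s t l

variable {κ : Type*}

/-- The multiset of the indices in `ι` that occur in a monomial. -/
def letters (ι κ : Type*) : (Bool ⊕ ι ⊕ κ →₀ ℕ) →+ Multiset ι :=
  Finsupp.liftAddHom fun t =>
    multiplesHom (Multiset ι) (Sum.elim 0 (Sum.elim (fun b => {b}) 0) t)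

/-- The image of a monomial in `S`, `T`, the `U b` and the `W k` under the linear section of
`x b ↦ S * U b`, `y b ↦ T * U b`, `z k ↦ W k`. -/
def sectionMonomial {x y : ι → Q} (h : ∀ b c, x b * y c = x c * y b) (z : κ → Q)
    (e : Bool ⊕ ι ⊕ κ →₀ ℕ) : Q :=
  multisetProd h (e (.inl true)) (e (.inl false)) (letters ι κ e) *
    e.prod fun t k => (Sum.elim 1 (Sum.elim 1 z) : Bool ⊕ ι ⊕ κ → Q) t ^ k

theorem prod_single_add (w : Bool ⊕ ι ⊕ κ → Q) (t : Bool ⊕ ι ⊕ κ) (e : Bool ⊕ ι ⊕ κ →₀ ℕ) :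
    ((Finsupp.single t 1 + e).prod fun t k => w t ^ k) = w t * e.prod fun t k => w t ^ k := by
  classical
  rw [Finsupp.prod_add_index' (by simp) fun _ _ _ => pow_add _ _ _,
    Finsupp.prod_single_index (by simp), pow_one]

theorem sectionMonomial_left {x y : ι → Q} (h : ∀ b c, x b * y c = x c * y b) (z : κ → Q)
    (b : ι) (e : Bool ⊕ ι ⊕ κ →₀ ℕ) :
    sectionMonomial h z (Finsupp.single (.inl true) 1 + (Finsupp.single (.inr (.inl b)) 1 + e)) =
      x b * sectionMonomial h z e := by
  rw [sectionMonomial, prod_single_add, prod_single_add, map_add, map_add, sectionMonomial]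
  simp only [letters, Finsupp.liftAddHom_apply_single, Finsupp.add_apply]
  simp [add_comm 1, multisetProd_succ_left, mul_assoc]

theorem sectionMonomial_right {x y : ι → Q} (h : ∀ b c, x b * y c = x c * y b) (z : κ → Q)
    (b : ι) (e : Bool ⊕ ι ⊕ κ →₀ ℕ) :
    sectionMonomial h z (Finsupp.single (.inl false) 1 + (Finsupp.single (.inr (.inl b)) 1 + e)) =
      y b * sectionMonomial h z e := by
  rw [sectionMonomial, prod_single_add, prod_single_add, map_add, map_add, sectionMonomial]
  simp only [letters, Finsupp.liftAddHom_apply_single, Finsupp.add_apply]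
  simp [add_comm 1, multisetProd_succ_right, mul_assoc]

theorem sectionMonomial_free {x y : ι → Q} (h : ∀ b c, x b * y c = x c * y b) (z : κ → Q)
    (k : κ) (e : Bool ⊕ ι ⊕ κ →₀ ℕ) :
    sectionMonomial h z (Finsupp.single (.inr (.inr k)) 1 + e) = z k * sectionMonomial h z e := by
  rw [sectionMonomial, prod_single_add, map_add, sectionMonomial]
  simp only [letters, Finsupp.liftAddHom_apply_single, Finsupp.add_apply]
  simp [mul_left_comm]

theorem sectionMonomial_zero {x y : ι → Q} (h : ∀ b c, x b * y c = x c * y b) (z : κ → Q) :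
    sectionMonomial h z 0 = 1 := by
  simp only [sectionMonomial, map_zero, Finsupp.prod_zero_index, mul_one]
  rfl

open MvPolynomial in
/-- The relations `x b * y c = x c * y b` generate the kernel of `x b ↦ S * U b`,
`y b ↦ T * U b`. -/
theorem eq_zero_of_segre_eq_zero {k σ : Type*} [CommRing k] [Algebra k Q]
    (π : MvPolynomial σ k →ₐ[k] Q) (φ : MvPolynomial σ k →ₐ[k] MvPolynomial (Bool ⊕ ι ⊕ κ) k)
    {x y : ι → Q} (h : ∀ b c, x b * y c = x c * y b) (z : κ → Q)
    (hφ : ∀ i, (φ (X i) = 0 ∧ π (X i) = 0) ∨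
      (∃ b, φ (X i) = X (.inl true) * X (.inr (.inl b)) ∧ π (X i) = x b) ∨
      (∃ b, φ (X i) = X (.inl false) * X (.inr (.inl b)) ∧ π (X i) = y b) ∨
      ∃ w, φ (X i) = X (.inr (.inr w)) ∧ π (X i) = z w)
    {f : MvPolynomial σ k} (hf : φ f = 0) : π f = 0 := by
  -- `ψ` is only linear, and monomials whose numbers of factors S, T and U do not match go to zero.
  -- It still intertwines multiplication by `φ (X i)` with multiplication by `π (X i)`, so `ψ ∘ φ =
  -- π`, and the kernel of `φ` lies in that of `π`.
  let ψ : MvPolynomial (Bool ⊕ ι ⊕ κ) k →ₗ[k] Q :=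
    (basisMonomials _ k).constr k (sectionMonomial h z)
  have hψ : ∀ e c, ψ (monomial e c) = c • sectionMonomial h z e := fun e c => by
    rw [show monomial e c = c • basisMonomials _ k e by
      rw [coe_basisMonomials, smul_monomial, smul_eq_mul, mul_one], map_smul,
      Module.Basis.constr_basis]
  have hX : ∀ i g, ψ (φ (X i) * g) = π (X i) * ψ g := fun i g => by
    induction g using MvPolynomial.induction_on' with
    | add p q hp hq => rw [mul_add, map_add, hp, hq, map_add, mul_add]
    | monomial e c =>
      rcases hφ i with ⟨h1, h2⟩ | ⟨b, h1, h2⟩ | ⟨b, h1, h2⟩ | ⟨w, h1, h2⟩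
      · rw [h1, h2, zero_mul, zero_mul, map_zero]
      · rw [h1, h2, mul_assoc, X, X, monomial_mul, monomial_mul, one_mul, one_mul, hψ, hψ,
          sectionMonomial_left, mul_smul_comm]
      · rw [h1, h2, mul_assoc, X, X, monomial_mul, monomial_mul, one_mul, one_mul, hψ, hψ,
          sectionMonomial_right, mul_smul_comm]
      · rw [h1, h2, X, monomial_mul, one_mul, hψ, hψ, sectionMonomial_free, mul_smul_comm]
  have hp : ∀ p g, ψ (φ p * g) = π p * ψ g := fun p => by
    induction p using MvPolynomial.induction_on with
    | C c =>
      intro g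
      rw [← algebraMap_eq, AlgHom.commutes, AlgHom.commutes, ← Algebra.smul_def, map_smul,
        Algebra.smul_def]
    | add p q hp hq => intro g; rw [map_add, add_mul, map_add, hp, hq, map_add, add_mul]
    | mul_X p i hp => intro g; rw [map_mul φ, mul_assoc, hp, hX, map_mul π, mul_assoc]
  have := hp f 1
  rw [hf, zero_mul, map_zero, show (1 : MvPolynomial (Bool ⊕ ι ⊕ κ) k) = monomial 0 1 from rfl, hψ, sectionMonomial_zero, one_smul,
    mul_one] at this
  exact this.symm

end Segre

/-! ### The ideals of Z(A|B) and V in the charts -/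

theorem minor_mem_idealZ {n : ℕ} {𝒜 : Set (Finset (Fin n))} {A : Finset (Fin n)} (hA : A ∈ 𝒜)
    (J : Fin 3 ↪o Fin n) {f : Fin 3 → Fin n} (hf : ∀ k, f k ∈ A) :
    minor (chartMatrix J) f ∈ idealZ 𝒜 J := by
  by_cases hi : Function.Injective f
  · obtain ⟨I, σ, rfl⟩ := exists_sorted hi
    rw [minor_comp_perm]
    refine Ideal.mul_mem_left _ _ (Ideal.subset_span ⟨A, hA, I, fun k => ?_, rfl⟩)
    simpa using hf (σ⁻¹ k)
  · rw [minor_eq_zero_of_not_injective _ hi]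
    exact zero_mem _

theorem minor_update {R : Type*} [CommRing R] {n : ℕ} {M : Matrix (Fin 3) (Fin n) R}
    {J : Fin 3 → Fin n} (hJ : M.submatrix id J = 1) (k : Fin 3) (a : Fin n) :
    minor M (Function.update J k a) = M k a := by
  have h : ∀ i j, M i (J j) = (1 : Matrix (Fin 3) (Fin 3) R) i j := fun i j => by rw [← hJ]; rfl
  fin_cases k <;> simp [minor, Matrix.det_fin_three, h]

/-- With the identity in the columns `J`, small minors of the other columns are themselves maximal
minors; this exhibits the Segre relations as elements of `idealZ`. -/
theorem minor_update_update {R : Type*} [CommRing R] {n : ℕ} {M : Matrix (Fin 3) (Fin n) R}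
    {J : Fin 3 → Fin n} (hJ : M.submatrix id J = 1) {k l : Fin 3} (hkl : k ≠ l) (a b : Fin n) :
    minor M (Function.update (Function.update J k a) l b) = M k a * M l b - M k b * M l a := by
  have h : ∀ i j, M i (J j) = (1 : Matrix (Fin 3) (Fin 3) R) i j := fun i j => by rw [← hJ]; rfl
  fin_cases k <;> fin_cases l <;> first | exact absurd rfl hkl | skip
  all_goals
    simp [minor, Matrix.det_fin_three, h, Function.update]
  all_goals ring

theorem minor_eq_zero_of_proportional_rows {R : Type*} [CommRing R] {n : ℕ}
    {M : Matrix (Fin 3) (Fin n) R} {f : Fin 3 → Fin n} {k l : Fin 3} (hkl : k ≠ l) {s t : R}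
    (h : ∀ i, ∃ u, M k (f i) = s * u ∧ M l (f i) = t * u) : minor M f = 0 := by
  choose u hk hl using h
  fin_cases k <;> fin_cases l <;> first | exact absurd rfl hkl | skip
  all_goals
    simp only [Fin.zero_eta, Fin.mk_one, Fin.reduceFinMk] at hk hl
    simp only [minor, Matrix.det_fin_three, Matrix.submatrix_apply, id, hk, hl]
    ring

theorem chartMatrix_submatrix {n : ℕ} (J : Fin 3 ↪o Fin n) :
    (chartMatrix J).submatrix id J = 1 := by
  ext1 i k
  simp [chartMatrix, Matrix.one_apply, eq_comm]

theorem chartMatrix_apply {n : ℕ} (J : Fin 3 ↪o Fin n) (i : Fin 3)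
    (j : {j : Fin n // j ∉ Set.range J}) : chartMatrix J i j = MvPolynomial.X (i, j) := by
  rw [chartMatrix, Matrix.of_apply, dif_pos j.2]

open Classical MvPolynomial in
/-- Over the chart `{p_J ≠ 0}`, the parametrization of `Z(A|B)` by products, when the columns
`J k` for `k ≠ l` are in `A` and `J l` is in `B`. -/
def chartParam {n : ℕ} (A : Finset (Fin n)) (J : Fin 3 ↪o Fin n) (k₀ k₁ l : Fin 3) :
    Fin 3 × {j : Fin n // j ∉ Set.range J} →
      MvPolynomial (Bool ⊕ {j : Fin n // j ∉ Set.range J} ⊕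
        Fin 3 × {j : Fin n // j ∉ Set.range J}) ℂ :=
  fun p =>
    if p.2.1 ∈ A then if p.1 = l then 0 else X (.inr (.inr p))
    else if p.1 = k₀ then X (.inl true) * X (.inr (.inl p.2))
    else if p.1 = k₁ then X (.inl false) * X (.inr (.inl p.2))
    else X (.inr (.inr p))

open MvPolynomial in
-- Columns in `A` have zero `l`-th coordinate. Columns in `B`, including the basis vector at `J l`,
-- have their `k₀` and `k₁` coordinates proportional to one fixed pair. So each part lies in a
-- plane.
theorem chartPoint_chartParam_mem_Z {n : ℕ} {A B : Finset (Fin n)} (hd : Disjoint A B)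
    (J : Fin 3 ↪o Fin n) {k₀ k₁ l : Fin 3} (h01 : k₀ ≠ k₁) (h0l : k₀ ≠ l) (h1l : k₁ ≠ l)
    (h0 : J k₀ ∈ A) (h1 : J k₁ ∈ A) (hl : J l ∈ B)
    (p : Bool ⊕ {j : Fin n // j ∉ Set.range J} ⊕ Fin 3 × {j : Fin n // j ∉ Set.range J} → ℂ) :
    chartPoint J (fun i => eval p (chartParam A J k₀ k₁ l i)) ∈ Z {A, B} := by
  have hlA : J l ∉ A := fun h => Finset.disjoint_left.1 hd h hl
  have hcase : ∀ k, k = k₀ ∨ k = k₁ ∨ k = l := by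
    revert h01 h0l h1l
    clear h0 h1 hl hlA
    revert k₀ k₁ l
    decide
  have hA : ∀ k, J k ∈ A → k ≠ l := by rintro k hk rfl; exact hlA hk
  set N := (chartMatrix J).map (eval fun i => eval p (chartParam A J k₀ k₁ l i)) with hN
  have hNJ : N.submatrix id J = 1 := by
    have := congrArg (fun M : Matrix (Fin 3) (Fin 3) (ChartRing J) =>
      M.map (eval fun i => eval p (chartParam A J k₀ k₁ l i))) (chartMatrix_submatrix J)
    rwa [Matrix.map_one _ (map_zero _) (map_one _)] at this
  have hNJ' : ∀ i k, N i (J k) = (1 : Matrix (Fin 3) (Fin 3) ℂ) i k := fun i k => by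
    rw [← hNJ]; rfl
  have hNX : ∀ i (j : {j : Fin n // j ∉ Set.range J}),
      N i j = eval p (chartParam A J k₀ k₁ l (i, j)) := fun i j => by
    rw [hN, Matrix.map_apply, chartMatrix_apply, eval_X]
  change rowSpan N ∈ _
  rw [mem_Z_rowSpan]
  · rintro C (rfl | rfl) f hf
    · refine Matrix.det_eq_zero_of_row_eq_zero l fun k => ?_
      rw [Matrix.submatrix_apply, id]
      have hk := hf k
      by_cases hr : f k ∈ Set.range J
      · obtain ⟨i, hi⟩ := hr
        rw [← hi] at hk ⊢
        rw [hNJ', Matrix.one_apply_ne (hA i hk).symm]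
      · rw [hNX l ⟨f k, hr⟩, chartParam]
        simp [hk]
    · refine minor_eq_zero_of_proportional_rows h01 (s := p (.inl true)) (t := p (.inl false))
        fun k => ?_
      have hk : f k ∉ A := fun h => Finset.disjoint_left.1 hd h (hf k)
      by_cases hr : f k ∈ Set.range J
      · obtain ⟨i, hi⟩ := hr
        rw [← hi] at hk ⊢
        obtain rfl : i = l := by
          rcases hcase i with rfl | rfl | rfl
          exacts [absurd h0 hk, absurd h1 hk, rfl]
        exact ⟨0, by rw [hNJ', Matrix.one_apply_ne h0l, mul_zero],
          by rw [hNJ', Matrix.one_apply_ne h1l, mul_zero]⟩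
      · refine ⟨p (.inr (.inl ⟨f k, hr⟩)), ?_, ?_⟩
        · rw [hNX k₀ ⟨f k, hr⟩, chartParam]
          simp [hk]
        · rw [hNX k₁ ⟨f k, hr⟩, chartParam]
          simp [hk, h01.symm]
  · refine rowSpan_mem_Gr.2 (rank_eq_of_det_ne_zero (f := J) ?_)
    rw [hNJ, Matrix.det_one]
    exact one_ne_zero

open MvPolynomial in
theorem idealV_le_idealZ_of_mem {n : ℕ} {A B : Finset (Fin n)} (hAB : A ∪ B = Finset.univ)
    (hd : Disjoint A B) (J : Fin 3 ↪o Fin n) {k₀ k₁ l : Fin 3} (h01 : k₀ ≠ k₁) (h0l : k₀ ≠ l)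
    (h1l : k₁ ≠ l) (h0 : J k₀ ∈ A) (h1 : J k₁ ∈ A) (hl : J l ∈ B) :
    idealV J ≤ idealZ {A, B} J := by
  classical
  intro f hf
  have hcase : ∀ k, k = k₀ ∨ k = k₁ ∨ k = l := by
    revert h01 h0l h1l
    clear h0 h1 hl
    revert k₀ k₁ l
    decide
  have hJ := chartMatrix_submatrix J
  have hzA : ∀ j : {j : Fin n // j ∉ Set.range J}, j.1 ∈ A → X (l, j) ∈ idealZ {A, B} J :=
    fun j hj => by
      rw [← chartMatrix_apply, ← minor_update hJ]
      refine minor_mem_idealZ (A := A) (by simp) J fun k => ?_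
      rcases hcase k with rfl | rfl | rfl
      · rwa [Function.update_of_ne h0l]
      · rwa [Function.update_of_ne h1l]
      · rwa [Function.update_self]
  have hxy : ∀ b c : {j : Fin n // j ∉ Set.range J}, b.1 ∉ A → c.1 ∉ A →
      X (k₀, b) * X (k₁, c) - X (k₀, c) * X (k₁, b) ∈ idealZ {A, B} J := fun b c hb hc => by
    have hB : ∀ j, j ∉ A → j ∈ B := fun j hj =>
      (Finset.mem_union.1 (hAB ▸ Finset.mem_univ j)).resolve_left hj
    simp only [← chartMatrix_apply]
    rw [← minor_update_update hJ h01]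
    refine minor_mem_idealZ (A := B) (by simp) J fun k => ?_
    rcases hcase k with rfl | rfl | rfl
    · rw [Function.update_of_ne h01, Function.update_self]
      exact hB _ hb
    · rw [Function.update_self]
      exact hB _ hc
    · rwa [Function.update_of_ne h1l.symm, Function.update_of_ne h0l.symm]
  -- The pullback of `f` vanishes at every complex point, so it is the zero polynomial.
  have hφ : aeval (chartParam A J k₀ k₁ l) f = 0 := by
    refine MvPolynomial.funext fun p => ?_
    have := (mem_vanishingIdeal_iff.1 hf) _
      (Z_subset_V hAB (chartPoint_chartParam_mem_Z hd J h01 h0l h1l h0 h1 hl p))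
    rw [map_zero, ← this, ← coe_aeval_eq_eval]
    exact comp_aeval_apply (chartParam A J k₀ k₁ l) (aeval p) f
  rw [← Ideal.Quotient.eq_zero_iff_mem]
  let π := Ideal.Quotient.mkₐ ℂ (idealZ {A, B} J)
  have hπ : ∀ g, g ∈ idealZ {A, B} J → π g = 0 := fun g => Ideal.Quotient.eq_zero_iff_mem.2
  refine eq_zero_of_segre_eq_zero π (aeval (chartParam A J k₀ k₁ l))
    -- The letters range over all columns outside `J`; those in `A` get the value zero so that the
    -- relations hold for every pair.
    (x := fun b => if b.1 ∈ A then 0 else π (X (k₀, b)))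
    (y := fun b => if b.1 ∈ A then 0 else π (X (k₁, b))) (fun b c => ?_)
    (fun i => π (X i)) (fun i => ?_) hφ
  · by_cases hb : b.1 ∈ A
    · simp [hb]
    · by_cases hc : c.1 ∈ A
      · simp [hc]
      · have := hπ _ (hxy b c hb hc)
        simpa [hb, hc, sub_eq_zero] using this
  · obtain ⟨i, j⟩ := i
    rw [aeval_X, chartParam]
    by_cases hj : j.1 ∈ A
    · by_cases hi : i = l
      · left
        simpa [hj, hi] using hπ _ (hzA j hj)
      · right; right; right
        exact ⟨(i, j), by simp [hj, hi], rfl⟩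
    · rcases hcase i with rfl | rfl | rfl
      · right; left
        exact ⟨j, by simp [hj], by simp [hj]⟩
      · right; right; left
        exact ⟨j, by simp [hj, h01.symm], by simp [hj]⟩
      · right; right; right
        exact ⟨(i, j), by simp [hj, h0l.symm, h1l.symm], rfl⟩

/-- If the three columns `J` lie in one part, then p_J = 1 is in the ideal and the chart misses
Z(A|B). Otherwise two lie in one part and one in the other. -/
theorem idealV_le_idealZ {n : ℕ} {A B : Finset (Fin n)} (hAB : A ∪ B = Finset.univ)
    (hd : Disjoint A B) (J : Fin 3 ↪o Fin n) : idealV J ≤ idealZ {A, B} J := by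
  have htop : ∀ C ∈ ({A, B} : Set (Finset (Fin n))), (∀ k, J k ∈ C) →
      idealZ {A, B} J = ⊤ := fun C hC h => by
    rw [Ideal.eq_top_iff_one]
    have := minor_mem_idealZ hC J h
    rwa [minor, chartMatrix_submatrix, Matrix.det_one] at this
  have hmem : ∀ k, J k ∈ A ∨ J k ∈ B := fun k =>
    Finset.mem_union.1 (hAB ▸ Finset.mem_univ (J k))
  rcases hmem 0 with h0 | h0 <;> rcases hmem 1 with h1 | h1 <;> rcases hmem 2 with h2 | h2
  · rw [htop A (by simp) (by simp [Fin.forall_fin_succ, h0, h1, h2])]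
    exact le_top
  · exact idealV_le_idealZ_of_mem hAB hd J (k₀ := 0) (k₁ := 1) (l := 2) (by decide) (by decide)
      (by decide) h0 h1 h2
  · exact idealV_le_idealZ_of_mem hAB hd J (k₀ := 0) (k₁ := 2) (l := 1) (by decide) (by decide)
      (by decide) h0 h2 h1
  · rw [Set.pair_comm]
    exact idealV_le_idealZ_of_mem (Finset.union_comm A B ▸ hAB) hd.symm J
      (k₀ := 1) (k₁ := 2) (l := 0) (by decide) (by decide) (by decide) h1 h2 h0
  · exact idealV_le_idealZ_of_mem hAB hd J (k₀ := 1) (k₁ := 2) (l := 0) (by decide) (by decide)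
      (by decide) h1 h2 h0
  · rw [Set.pair_comm]
    exact idealV_le_idealZ_of_mem (Finset.union_comm A B ▸ hAB) hd.symm J
      (k₀ := 0) (k₁ := 2) (l := 1) (by decide) (by decide) (by decide) h0 h2 h1
  · rw [Set.pair_comm]
    exact idealV_le_idealZ_of_mem (Finset.union_comm A B ▸ hAB) hd.symm J
      (k₀ := 0) (k₁ := 1) (l := 2) (by decide) (by decide) (by decide) h0 h1 h2
  · rw [htop B (by simp) (by simp [Fin.forall_fin_succ, h0, h1, h2])]
    exact le_top

/-! ### Totally nonnegative cyclic configurations of vectors in `ℝ³` -/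

/-- The determinant of three members of a sequence of vectors. -/
def tripleDet {R : Type*} [CommRing R] (v : ℕ → Fin 3 → R) (i j k : ℕ) : R :=
  v i 0 * (v j 1 * v k 2 - v j 2 * v k 1) - v i 1 * (v j 0 * v k 2 - v j 2 * v k 0) +
    v i 2 * (v j 0 * v k 1 - v j 1 * v k 0)

section tripleDet

variable {R : Type*} [CommRing R] (v : ℕ → Fin 3 → R)

theorem tripleDet_cyclic (i j k : ℕ) : tripleDet v i j k = tripleDet v j k i := by
  simp only [tripleDet]; ring

theorem tripleDet_swap (i j k : ℕ) : tripleDet v i j k = -tripleDet v j i k := by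
  simp only [tripleDet]; ring

@[simp] theorem tripleDet_self_left (i j : ℕ) : tripleDet v i i j = 0 := by
  simp only [tripleDet]; ring

@[simp] theorem tripleDet_self_right (i j : ℕ) : tripleDet v i j j = 0 := by
  simp only [tripleDet]; ring

@[simp] theorem tripleDet_self_outer (i j : ℕ) : tripleDet v i j i = 0 := by
  simp only [tripleDet]; ring

/-- The three-term Plücker relation. -/
theorem tripleDet_three_term (a b x y z : ℕ) :
    tripleDet v a b x * tripleDet v a y z =
      tripleDet v a b y * tripleDet v a x z + tripleDet v a b z * tripleDet v a y x := by
  simp only [tripleDet]; ring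

/-- Cramer's rule for `v x` in terms of `v a`, `v b`, `v c`, paired with `v y` and `v z`. -/
theorem tripleDet_cramer (a b c x y z : ℕ) :
    tripleDet v a b c * tripleDet v x y z =
      tripleDet v x b c * tripleDet v a y z + tripleDet v a x c * tripleDet v b y z +
        tripleDet v a b x * tripleDet v c y z := by
  simp only [tripleDet]; ring

/-- For parallel `v a` and `v c` the right side is zero, so determinants containing `v a` are
proportional to those with `v c` in its place. -/
theorem tripleDet_exchange (a c b w x y : ℕ) :
    tripleDet v c x y * tripleDet v a b w - tripleDet v a x y * tripleDet v c b w =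
      tripleDet v a c x * tripleDet v y b w - tripleDet v a c y * tripleDet v x b w := by
  simp only [tripleDet]; ring

end tripleDet

theorem exists_mod_eq {n : ℕ} (hn : 0 < n) (i x : ℕ) :
    ∃ y, i ≤ y ∧ y < i + n ∧ y % n = x % n := by
  obtain ⟨m, rfl⟩ := Nat.exists_eq_add_one.2 hn
  -- Modulo n = m + 1, the number x + i * m represents x - i.
  refine ⟨i + (x + i * m) % (m + 1), Nat.le_add_right _ _,
    Nat.add_lt_add_left (Nat.mod_lt _ hn) _, ?_⟩
  rw [Nat.add_mod_mod, show i + (x + i * m) = x + i * (m + 1) by ring, Nat.add_mul_mod_self_right]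

/-- A sequence of vectors of period `n` whose determinants in cyclic order are nonnegative, and
with no two adjacent members parallel. -/
structure IsCyclicConfig (n : ℕ) (v : ℕ → Fin 3 → ℝ) : Prop where
  periodic : ∀ j, v (j + n) = v j
  nonneg : ∀ i j k, i < j → j < k → k < i + n → 0 ≤ tripleDet v i j k
  adjacent : ∀ i, ∃ x, tripleDet v i (i + 1) x ≠ 0

namespace IsCyclicConfig

variable {n : ℕ} {v : ℕ → Fin 3 → ℝ}

theorem nonneg_of_le (h : IsCyclicConfig n v) {i j k : ℕ} (hij : i ≤ j) (hjk : j ≤ k)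
    (hk : k ≤ i + n) : 0 ≤ tripleDet v i j k := by
  rcases hij.eq_or_lt with rfl | hij
  · simp
  rcases hjk.eq_or_lt with rfl | hjk
  · simp
  rcases hk.eq_or_lt with rfl | hk
  · simp [tripleDet, h.periodic]
    linarith
  · exact h.nonneg i j k hij hjk hk

theorem exists_eq_mem_Ico (h : IsCyclicConfig n v) (hn : 0 < n) (i x : ℕ) :
    ∃ y, i ≤ y ∧ y < i + n ∧ v y = v x := by
  obtain ⟨y, h1, h2, hy⟩ := exists_mod_eq hn i x
  have hp : Function.Periodic v n := h.periodic
  exact ⟨y, h1, h2, by rw [← hp.map_mod_nat, hy, hp.map_mod_nat]⟩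

theorem exists_tripleDet_ne_zero (h : IsCyclicConfig n v) (hn : 0 < n) (i : ℕ) :
    ∃ x, i + 2 ≤ x ∧ x < i + n ∧ tripleDet v i (i + 1) x ≠ 0 := by
  obtain ⟨x, hx⟩ := h.adjacent i
  obtain ⟨y, h1, h2, hy⟩ := h.exists_eq_mem_Ico hn i x
  have hxy : tripleDet v i (i + 1) y ≠ 0 := by
    rw [tripleDet] at hx ⊢
    rwa [hy]
  refine ⟨y, ?_, h2, hxy⟩
  by_contra hlt
  obtain rfl | rfl : y = i ∨ y = i + 1 := by omega
  · simp at hxy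
  · simp at hxy

/-- Moving the first of three vectors to the end is an even permutation, so going around the cycle
costs no sign. -/
theorem tripleDet_rotate (h : IsCyclicConfig n v) (i j k : ℕ) :
    tripleDet v j k (i + n) = tripleDet v i j k := by
  simp only [tripleDet, h.periodic]
  ring

/-- If the determinant vanished, three-term relations with nonnegative terms would make `v x`
dependent on each two of the basis vectors `v i`, `v (i + 1)`, `v (i + 2)`. Then `v x = 0`, against
`hc x`. -/
theorem adjacent_pos (h : IsCyclicConfig n v) (hc : ∀ i, 0 < tripleDet v i (i + 1) (i + 2))
    {i x : ℕ} (hx : i + 2 ≤ x) (hxn : x < i + n) : 0 < tripleDet v i (i + 1) x := by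
  have hlast : ∀ N, N + 1 = i + n → 0 < tripleDet v i (i + 1) N := fun N hN => by
    have := hc N
    rw [show N + 2 = i + 1 + n by omega, h.tripleDet_rotate, hN, h.tripleDet_rotate] at this
    exact this
  rcases hx.eq_or_lt with rfl | hx
  · exact hc i
  rcases (Nat.succ_le_of_lt hxn).eq_or_lt with hN | hN
  · exact hlast x hN
  obtain ⟨N, hN'⟩ : ∃ N, N + 1 = i + n := ⟨i + n - 1, by omega⟩
  refine lt_of_le_of_ne (h.nonneg_of_le (by omega) (by omega) (by omega)) fun h0 => ?_
  have p1 := hc i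
  have p2 := hlast N hN'
  have n1 : 0 ≤ tripleDet v i x N := h.nonneg_of_le (by omega) (by omega) (by omega)
  have n2 : 0 ≤ tripleDet v i (i + 2) x := h.nonneg_of_le (by omega) (by omega) (by omega)
  have n3 : 0 ≤ tripleDet v (i + 1) x N := h.nonneg_of_le (by omega) (by omega) (by omega)
  have n4 : 0 ≤ tripleDet v (i + 1) (i + 2) x := h.nonneg_of_le (by omega) (by omega) (by omega)
  have e1 := tripleDet_three_term v i (i + 1) x (i + 2) N
  have e2 := tripleDet_three_term v (i + 1) i x (i + 2) N
  rw [← h0, zero_mul] at e1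
  rw [tripleDet_swap v (i + 1) i x, ← h0, tripleDet_swap v (i + 1) i (i + 2),
    tripleDet_swap v (i + 1) i N] at e2
  have z2 : tripleDet v i (i + 2) x = 0 := by
    by_contra hne
    have := mul_pos p2 (lt_of_le_of_ne n2 (Ne.symm hne))
    have := mul_nonneg p1.le n1
    linarith
  have z4 : tripleDet v (i + 1) (i + 2) x = 0 := by
    by_contra hne
    have := mul_pos p2 (lt_of_le_of_ne n4 (Ne.symm hne))
    have := mul_nonneg p1.le n3
    linarith
  have e3 := tripleDet_cramer v i (i + 1) (i + 2) x (x + 1) (x + 2)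
  have c1 : tripleDet v x (i + 1) (i + 2) = 0 := by rw [tripleDet_cyclic, z4]
  have c2 : tripleDet v i x (i + 2) = 0 := by
    rw [tripleDet_swap, tripleDet_cyclic, z2, neg_zero]
  rw [c1, c2, ← h0] at e3
  have := mul_pos p1 (hc x)
  linarith

/-- One three-term relation reduces to determinants with an adjacent pair: it has a positive term,
and nonnegativity of the other replaces an induction. -/
theorem tripleDet_pos (h : IsCyclicConfig n v) (hc : ∀ i, 0 < tripleDet v i (i + 1) (i + 2))
    {i j k : ℕ} (hij : i < j) (hjk : j < k) (hk : k < i + n) : 0 < tripleDet v i j k := by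
  rcases (Nat.succ_le_of_lt hij).eq_or_lt with rfl | hij
  · exact h.adjacent_pos hc hjk hk
  obtain ⟨z, rfl⟩ : ∃ z, k = z + 1 := ⟨k - 1, by omega⟩
  have hlast : 0 < tripleDet v i z (z + 1) := by
    rw [← h.tripleDet_rotate]
    exact h.adjacent_pos hc (by omega) (by omega)
  rcases (Nat.le_of_lt_succ hjk).eq_or_lt with rfl | hjz
  · exact hlast
  have e := tripleDet_three_term v i (i + 1) z j (z + 1)
  have p1 : 0 < tripleDet v i (i + 1) j := h.adjacent_pos hc hij (by omega)
  have p2 : 0 ≤ tripleDet v i (i + 1) z := (h.adjacent_pos hc (by omega) (by omega)).le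
  have p3 : 0 ≤ tripleDet v i (i + 1) (z + 1) := (h.adjacent_pos hc (by omega) hk).le
  have p4 : 0 ≤ tripleDet v i j z := h.nonneg_of_le (by omega) (by omega) (by omega)
  refine pos_of_mul_pos_right (a := tripleDet v i (i + 1) z) ?_ p2
  rw [e]
  exact add_pos_of_pos_of_nonneg (mul_pos p1 hlast) (mul_nonneg p3 p4)

theorem exists_consecutive (h : IsCyclicConfig n v) (hn : 3 ≤ n) {i j k : ℕ} (hij : i < j)
    (hjk : j < k) (hk : k < i + n) (h0 : tripleDet v i j k = 0) :
    ∃ i, tripleDet v i (i + 1) (i + 2) = 0 := by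
  by_contra! hne
  exact (h.tripleDet_pos (fun i => lt_of_le_of_ne
    (h.nonneg_of_le (by omega) (by omega) (by omega)) (hne i).symm) hij hjk hk).ne' h0

/-- If `v i` and `v (i + 2)` are parallel, then all the vectors other than `v (i + 1)` lie in a
plane. -/
theorem tripleDet_eq_zero_of_parallel (h : IsCyclicConfig n v) (hn : 5 ≤ n) {i : ℕ}
    (hp : ∀ x, tripleDet v i (i + 2) x = 0) {x y z : ℕ} (hx : i + 3 ≤ x ∧ x < i + n)
    (hy : i + 3 ≤ y ∧ y < i + n) (hz : i + 3 ≤ z ∧ z < i + n) : tripleDet v x y z = 0 := by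
  obtain ⟨w, hw1, hw2, hw⟩ := h.exists_tripleDet_ne_zero (by omega) i
  obtain ⟨w', hw'⟩ := h.adjacent (i + 1)
  have pw : 0 < tripleDet v i (i + 1) w :=
    lt_of_le_of_ne (h.nonneg_of_le (by omega) (by omega) (by omega)) hw.symm
  -- Thus `v (i + 2)` is a negative multiple of `v i`. Nonnegative determinants of both with later
  -- vectors must then vanish, which puts all those vectors in one plane through `v i`.
  have nw : tripleDet v (i + 2) (i + 1) w < 0 := by
    have n1 : 0 ≤ tripleDet v (i + 1) (i + 2) w :=
      h.nonneg_of_le (by omega) (by omega) (by omega)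
    rw [tripleDet_swap]
    refine neg_lt_zero.2 (lt_of_le_of_ne n1 fun h0 => ?_)
    have e := tripleDet_exchange v i (i + 2) (i + 1) w (i + 1) w'
    rw [hp, hp, tripleDet_swap v (i + 2) (i + 1) w, ← h0, tripleDet_swap] at e
    have := mul_ne_zero hw' hw
    apply this
    linarith
  have key : ∀ x y, i + 3 ≤ x → x ≤ y → y < i + n → tripleDet v i x y = 0 := fun x y h1 h2 h3 => by
    have e := tripleDet_exchange v i (i + 2) (i + 1) w x y
    rw [hp, hp] at e
    have n1 : 0 ≤ tripleDet v i x y := h.nonneg_of_le (by omega) (by omega) (by omega)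
    have n2 : 0 ≤ tripleDet v (i + 2) x y := h.nonneg_of_le (by omega) (by omega) (by omega)
    by_contra hne
    have := mul_neg_of_pos_of_neg (lt_of_le_of_ne n1 (Ne.symm hne)) nw
    have := mul_nonneg n2 pw.le
    linarith
  have key' : ∀ x y, (i + 3 ≤ x ∧ x < i + n) → (i + 3 ≤ y ∧ y < i + n) →
      tripleDet v i x y = 0 := fun x y h1 h2 => by
    rcases le_total x y with hxy | hxy
    · exact key x y h1.1 hxy h2.2
    · rw [tripleDet_cyclic, tripleDet_swap, ← tripleDet_cyclic, key y x h2.1 hxy h1.2, neg_zero]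
  have e := tripleDet_cramer v x y z i (i + 1) w
  rw [key' y z hy hz, tripleDet_swap v x i z, key' x z hx hz, ← tripleDet_cyclic v i x y,
    key' x y hx hy] at e
  have e' : tripleDet v x y z * tripleDet v i (i + 1) w = 0 := by linarith
  exact (mul_eq_zero.1 e').resolve_right hw

/-- Two vectors on a line through three consecutive ones are not separated by two vectors off
this line on the arc of the other vectors. -/
theorem tripleDet_ne_zero_of_between (h : IsCyclicConfig n v) {i x y z : ℕ}
    (hac : ∀ x, tripleDet v i (i + 1) x = 0 → tripleDet v (i + 1) (i + 2) x = 0)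
    (hca : ∀ x, tripleDet v (i + 1) (i + 2) x = 0 → tripleDet v i (i + 1) x = 0)
    (hiy : i + 3 ≤ y) (hyx : y < x) (hxz : x < z) (hz : z < i + n)
    (h1 : tripleDet v i (i + 1) y ≠ 0) (h2 : tripleDet v i (i + 1) z ≠ 0) :
    tripleDet v i (i + 1) x ≠ 0 := by
  intro h0
  -- The three-term relation is a vanishing sum of nonnegative products. Used for `a = i` and `a = i
  -- + 1`, it makes all coordinates of `v x` in the basis `v i`, `v (i + 1)`, `v z` vanish, against
  -- adjacency at `x`.
  have aux : ∀ a b, i ≤ a → a < b → b < y → tripleDet v a b y ≠ 0 →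
      tripleDet v a b z ≠ 0 → tripleDet v a b x = 0 → tripleDet v a x z = 0 :=
      fun a b ha hab hby h1 h2 h3 => by
    have e := tripleDet_three_term v a b x y z
    rw [h3, zero_mul] at e
    have p1 : 0 < tripleDet v a b y :=
      lt_of_le_of_ne (h.nonneg_of_le (by omega) (by omega) (by omega)) h1.symm
    have p2 : 0 ≤ tripleDet v a b z := h.nonneg_of_le (by omega) (by omega) (by omega)
    have p3 : 0 ≤ tripleDet v a x z := h.nonneg_of_le (by omega) (by omega) (by omega)
    have p4 : 0 ≤ tripleDet v a y x := h.nonneg_of_le (by omega) (by omega) (by omega)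
    by_contra hne
    have := mul_pos p1 (lt_of_le_of_ne p3 (Ne.symm hne))
    have := mul_nonneg p2 p4
    linarith
  have e1 := aux i (i + 1) le_rfl (by omega) (by omega) h1 h2 h0
  have e2 := aux (i + 1) (i + 2) (by omega) (by omega) (by omega) (fun h3 => h1 (hca _ h3))
    (fun h3 => h2 (hca _ h3)) (hac _ h0)
  obtain ⟨w, hw⟩ := h.adjacent x
  have e := tripleDet_cramer v i (i + 1) z x (x + 1) w
  have c1 : tripleDet v x (i + 1) z = 0 := by rw [tripleDet_swap, e2, neg_zero]
  rw [c1, e1, h0] at e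
  refine mul_ne_zero h2 hw (e.trans ?_)
  ring

/-- A configuration on a conic with three consecutive vectors in a plane consists of two arcs, each
of them in a plane. -/
theorem exists_two_arcs_of_consecutive (h : IsCyclicConfig n v) (hn : 5 ≤ n)
    (hconic : ∀ a b c d e f, tripleDet v a b c * tripleDet v a d e * tripleDet v b d f *
        tripleDet v c e f =
      tripleDet v a b d * tripleDet v a c e * tripleDet v b c f * tripleDet v d e f) {i : ℕ}
    (h0 : tripleDet v i (i + 1) (i + 2) = 0) :
    ∃ p m, 2 ≤ m ∧ m + 2 ≤ n ∧
      (∀ x y z, (p ≤ x ∧ x < p + m) → (p ≤ y ∧ y < p + m) → (p ≤ z ∧ z < p + m) →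
        tripleDet v x y z = 0) ∧
      (∀ x y z, (p + m ≤ x ∧ x < p + n) → (p + m ≤ y ∧ y < p + n) → (p + m ≤ z ∧ z < p + n) →
        tripleDet v x y z = 0) := by
  -- The conic argument needs three distinct points on the line. If the outer two coincide, the arcs
  -- are the three vectors and the rest, which has at least two members as `5 ≤ n`.
  by_cases hp : ∀ x, tripleDet v i (i + 2) x = 0
  · refine ⟨i, 3, by omega, by omega, fun x y z hx hy hz => ?_,
      fun x y z hx hy hz => h.tripleDet_eq_zero_of_parallel hn hp hx hy hz⟩
    have hx' : x = i ∨ x = i + 1 ∨ x = i + 2 := by omega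
    have hy' : y = i ∨ y = i + 1 ∨ y = i + 2 := by omega
    have hz' : z = i ∨ z = i + 1 ∨ z = i + 2 := by omega
    have e1 := tripleDet_cyclic v i (i + 1) (i + 2)
    have e2 := tripleDet_cyclic v (i + 1) (i + 2) i
    have e3 := hp (i + 1)
    have e4 := tripleDet_cyclic v i (i + 2) (i + 1)
    have e5 := tripleDet_cyclic v (i + 2) (i + 1) i
    rcases hx' with rfl | rfl | rfl <;> rcases hy' with rfl | rfl | rfl <;>
      rcases hz' with rfl | rfl | rfl <;> (try simp) <;> linarith
  push Not at hp
  obtain ⟨w₁, hw₁, hw₁', hw1⟩ := h.exists_tripleDet_ne_zero (by omega) i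
  obtain ⟨w₂, hw2⟩ := h.adjacent (i + 1)
  obtain ⟨w₃, hw3⟩ := hp
  have h0' : tripleDet v (i + 1) i (i + 2) = 0 := by rw [tripleDet_swap, h0, neg_zero]
  have hba : ∀ x, tripleDet v (i + 1) i x = -tripleDet v i (i + 1) x := tripleDet_swap v (i + 1) i
  have hab_bc : ∀ x, tripleDet v i (i + 1) x = 0 → tripleDet v (i + 1) (i + 2) x = 0 :=
      fun x hx => by
    have e := tripleDet_three_term v (i + 1) i x (i + 2) w₁
    rw [hba, hx, h0', hba] at e
    have e' : tripleDet v i (i + 1) w₁ * tripleDet v (i + 1) (i + 2) x = 0 := by linarith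
    exact (mul_eq_zero.1 e').resolve_left hw1
  have hbc_ab : ∀ x, tripleDet v (i + 1) (i + 2) x = 0 → tripleDet v i (i + 1) x = 0 :=
      fun x hx => by
    have e := tripleDet_three_term v (i + 1) i x (i + 2) w₂
    rw [hx, h0', hba] at e
    have e' : tripleDet v i (i + 1) x * tripleDet v (i + 1) (i + 2) w₂ = 0 := by linarith
    exact (mul_eq_zero.1 e').resolve_right hw2
  have hac_ab : ∀ x, tripleDet v i (i + 2) x = 0 → tripleDet v i (i + 1) x = 0 :=
      fun x hx => by
    have e := tripleDet_three_term v i (i + 1) x (i + 2) w₃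
    rw [hx, h0] at e
    have e' : tripleDet v i (i + 1) x * tripleDet v i (i + 2) w₃ = 0 := by linarith
    exact (mul_eq_zero.1 e').resolve_right hw3
  -- In the conic relation for the three collinear points and `x`, `y`, `z`, one side contains the
  -- zero determinant and the other is `tripleDet v x y z` times nonzero factors.
  have hoff : ∀ x y z, tripleDet v i (i + 1) x ≠ 0 → tripleDet v i (i + 1) y ≠ 0 →
      tripleDet v i (i + 1) z ≠ 0 → tripleDet v x y z = 0 := fun x y z hx hy hz => by
    have e := hconic i (i + 1) x (i + 2) y z
    rw [h0, zero_mul, zero_mul, zero_mul] at e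
    exact (mul_eq_zero.1 e).resolve_left (mul_ne_zero (mul_ne_zero hx fun h' => hy (hac_ab _ h'))
      fun h' => hz (hbc_ab _ h'))
  have hon : ∀ x y z, tripleDet v i (i + 1) x = 0 → tripleDet v i (i + 1) y = 0 →
      tripleDet v i (i + 1) z = 0 → tripleDet v x y z = 0 := fun x y z hx hy hz => by
    have e1 := tripleDet_three_term v i (i + 1) w₁ y z
    have e2 := tripleDet_three_term v (i + 1) i w₁ y z
    rw [hy, hz, zero_mul, zero_mul, add_zero] at e1
    rw [hba, hba, hba, hy, hz, neg_zero, zero_mul, zero_mul, add_zero] at e2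
    have e := tripleDet_cramer v i (i + 1) w₁ x y z
    rw [(mul_eq_zero.1 e1).resolve_left hw1, hx,
      (mul_eq_zero.1 e2).resolve_left (neg_ne_zero.2 hw1)] at e
    have e' : tripleDet v i (i + 1) w₁ * tripleDet v x y z = 0 := by linarith
    exact (mul_eq_zero.1 e').resolve_left hw1
  classical
  let S := (Finset.Ico (i + 3) (i + n)).filter fun x => tripleDet v i (i + 1) x ≠ 0
  have hS : ∀ x, x ∈ S ↔ (i + 3 ≤ x ∧ x < i + n) ∧ tripleDet v i (i + 1) x ≠ 0 := fun x => by
    simp [S]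
  have hne : S.Nonempty := by
    refine ⟨w₁, (hS _).2 ⟨⟨?_, hw₁'⟩, hw1⟩⟩
    refine Nat.succ_le_of_lt (lt_of_le_of_ne hw₁ ?_)
    rintro rfl
    exact hw1 h0
  obtain ⟨⟨hp1, hp2⟩, hp3⟩ := (hS _).1 (S.min'_mem hne)
  obtain ⟨⟨hq1, hq2⟩, hq3⟩ := (hS _).1 (S.max'_mem hne)
  have hleast : ∀ x, i ≤ x → x < S.min' hne → tripleDet v i (i + 1) x = 0 := fun x h1 h2 => by
    by_contra hx
    rcases Nat.lt_or_ge x (i + 3) with h3 | h3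
    · obtain rfl | rfl | rfl : x = i ∨ x = i + 1 ∨ x = i + 2 := by omega
      · simp at hx
      · simp at hx
      · exact hx h0
    · exact absurd (S.min'_le x ((hS x).2 ⟨⟨h3, by omega⟩, hx⟩)) (by omega)
  have hgreatest : ∀ x, S.max' hne < x → x < i + n → tripleDet v i (i + 1) x = 0 :=
      fun x h1 h2 => by
    by_contra hx
    exact absurd (S.le_max' x ((hS x).2 ⟨⟨by omega, h2⟩, hx⟩)) (by omega)
  have hpq := S.min'_le _ (S.max'_mem hne)
  generalize S.min' hne = p at *
  generalize S.max' hne = q at *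
  have hmid : ∀ x, p ≤ x → x ≤ q → tripleDet v i (i + 1) x ≠ 0 := fun x h1 h2 => by
    rcases h1.eq_or_lt with rfl | h1
    · exact hp3
    rcases h2.eq_or_lt with rfl | h2
    · exact hq3
    exact h.tripleDet_ne_zero_of_between hab_bc hbc_ab hp1 h1 h2 hq2 hp3 hq3
  -- This range runs past `i + n`; the indices beyond it are those before `p`, by periodicity.
  have hout : ∀ x, q < x → x < p + n → tripleDet v i (i + 1) x = 0 := fun x h1 h2 => by
    rcases Nat.lt_or_ge x (i + n) with h3 | h3
    · exact hgreatest x h1 h3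
    · obtain ⟨y, rfl⟩ := Nat.exists_eq_add_of_le' (show n ≤ x by omega)
      have := hleast y (by omega) (by omega)
      rwa [tripleDet, ← h.periodic y] at this
  -- With a single vector off the line, its arc is extended by the next index to reach size two; two
  -- vectors always lie in a plane.
  rcases hpq.eq_or_lt with rfl | hpq
  · refine ⟨p, 2, le_rfl, by omega, fun x y z hx hy hz => ?_, fun x y z hx hy hz =>
      hon x y z (hout x (by omega) hx.2) (hout y (by omega) hy.2) (hout z (by omega) hz.2)⟩
    obtain rfl | rfl | rfl : x = y ∨ y = z ∨ x = z := by omega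
    all_goals simp
  · exact ⟨p, q + 1 - p, by omega, by omega, fun x y z hx hy hz =>
      hoff x y z (hmid x hx.1 (by omega)) (hmid y hy.1 (by omega)) (hmid z hz.1 (by omega)),
      fun x y z hx hy hz => hon x y z (hout x (by omega) hx.2) (hout y (by omega) hy.2)
        (hout z (by omega) hz.2)⟩

end IsCyclicConfig

/-! ### Columns as a periodic sequence -/

section index

variable {n : ℕ} (hn : 0 < n)

/-- The residue of a natural number modulo `n`, as an index of a column. -/
def residue (j : ℕ) : Fin n := ⟨j % n, Nat.mod_lt _ hn⟩

theorem residue_val (x : Fin n) : residue hn x = x :=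
  Fin.ext (Nat.mod_eq_of_lt x.2)

theorem finRotate_residue (j : ℕ) : finRotate n (residue hn j) = residue hn (j + 1) := by
  obtain ⟨m, rfl⟩ := Nat.exists_eq_add_one.2 hn
  rw [finRotate_apply]
  apply Fin.ext
  simp [Fin.val_add, residue]

theorem finRotate_pow_residue (p k : ℕ) :
    (finRotate n ^ k) (residue hn p) = residue hn (p + k) := by
  induction k with
  | zero => simp
  | succ k ih => rw [pow_succ', Equiv.Perm.mul_apply, ih, finRotate_residue]; rfl

theorem eq_of_residue_eq {p x y : ℕ} (hx : p ≤ x ∧ x < p + n) (hy : p ≤ y ∧ y < p + n)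
    (h : residue hn x = residue hn y) : x = y := by
  have key : ∀ x y, p ≤ x → x ≤ y → y < p + n → x % n = y % n → x = y := fun x y h1 h2 h3 h4 => by
    have := Nat.eq_zero_of_dvd_of_lt (Nat.dvd_of_mod_eq_zero (Nat.sub_mod_eq_zero_of_mod_eq h4.symm))
      (show y - x < n by omega)
    omega
  have h' : x % n = y % n := congrArg Fin.val h
  rcases le_total x y with hxy | hxy
  · exact key x y hx.1 hxy hy.2 h'
  · exact (key y x hy.1 hxy hx.2 h'.symm).symm

theorem exists_residue_eq (p : ℕ) (x : Fin n) : ∃ y, p ≤ y ∧ y < p + n ∧ residue hn y = x := by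
  obtain ⟨y, h1, h2, hy⟩ := exists_mod_eq hn p x
  exact ⟨y, h1, h2, Fin.ext (hy.trans (Nat.mod_eq_of_lt x.2))⟩

/-- The cyclic interval of length `m` that starts at `p`. -/
def arc (p m : ℕ) : Finset (Fin n) :=
  (Finset.range m).image fun k => (finRotate n ^ k) (residue hn p)

theorem mem_arc {p m : ℕ} {x : Fin n} :
    x ∈ arc hn p m ↔ ∃ y, (p ≤ y ∧ y < p + m) ∧ residue hn y = x := by
  simp only [arc, Finset.mem_image, Finset.mem_range, finRotate_pow_residue]
  constructor
  · rintro ⟨k, hk, rfl⟩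
    exact ⟨p + k, by omega, rfl⟩
  · rintro ⟨y, hy, rfl⟩
    exact ⟨y - p, by omega, by rw [Nat.add_sub_cancel' hy.1]⟩

theorem card_arc {p m : ℕ} (hm : m ≤ n) : (arc hn p m).card = m := by
  rw [arc, Finset.card_image_of_injOn, Finset.card_range]
  intro k hk l hl hkl
  simp only [Finset.coe_range, Set.mem_Iio] at hk hl
  simp only [finRotate_pow_residue] at hkl
  have := eq_of_residue_eq hn (p := p) (by omega) (by omega) hkl
  omega

theorem isCyclicPartition_arc {p m : ℕ} (h2 : 2 ≤ m) (hm : m + 2 ≤ n) :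
    IsCyclicPartition (arc hn p m) (arc hn (p + m) (n - m)) := by
  refine ⟨⟨_, _, rfl⟩, ⟨_, _, rfl⟩, Finset.disjoint_left.2 fun x hx hx' => ?_,
    Finset.eq_univ_iff_forall.2 fun x => ?_, ?_, ?_⟩
  · obtain ⟨y, hy, rfl⟩ := (mem_arc hn).1 hx
    obtain ⟨z, hz, hyz⟩ := (mem_arc hn).1 hx'
    have := eq_of_residue_eq hn (p := p) (by omega) (by omega) hyz
    omega
  · obtain ⟨y, h1, h2, rfl⟩ := exists_residue_eq hn p x
    rw [Finset.mem_union, mem_arc, mem_arc]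
    rcases Nat.lt_or_ge y (p + m) with h3 | h3
    · exact Or.inl ⟨y, ⟨h1, h3⟩, rfl⟩
    · exact Or.inr ⟨y, ⟨h3, by omega⟩, rfl⟩
  · rw [card_arc hn (by omega)]
    exact h2
  · rw [card_arc hn (by omega)]
    omega

/-- The columns of a matrix as a periodic sequence. -/
def columns {R : Type*} (M : Matrix (Fin 3) (Fin n) R) (j : ℕ) (r : Fin 3) : R := M r (residue hn j)

theorem tripleDet_columns {R : Type*} [CommRing R] (M : Matrix (Fin 3) (Fin n) R) (i j k : ℕ) :
    tripleDet (columns hn M) i j k = minor M ![residue hn i, residue hn j, residue hn k] := by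
  simp only [tripleDet, columns, minor, Matrix.det_fin_three, Matrix.submatrix_apply, id,
    Matrix.cons_val]
  ring

theorem minor_eq_tripleDet {R : Type*} [CommRing R] {M : Matrix (Fin 3) (Fin n) R}
    {f : Fin 3 → Fin n} {y : Fin 3 → ℕ} (hy : ∀ k, residue hn (y k) = f k) :
    minor M f = tripleDet (columns hn M) (y 0) (y 1) (y 2) := by
  rw [tripleDet_columns]
  congr 1
  ext k
  fin_cases k <;> simp [hy]

/-- Reduction modulo `n` leaves a cyclic rotation of an increasing triple, according to which
indices wrap around, and rotations of three columns are even. -/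
theorem tripleDet_columns_nonneg {M : Matrix (Fin 3) (Fin n) ℝ} (hM : ∀ I, 0 ≤ plucker M I)
    {i j k : ℕ} (hij : i < j) (hjk : j < k) (hk : k < i + n) :
    0 ≤ tripleDet (columns hn M) i j k := by
  have hsorted : ∀ a b c : Fin n, a < b → b < c → 0 ≤ minor M ![a, b, c] := fun a b c hab hbc => by
    have hmono : StrictMono ![a, b, c] := by
      rw [Fin.strictMono_iff_lt_succ]
      intro l
      fin_cases l
      exacts [hab, hbc]
    exact hM (OrderEmbedding.ofStrictMono _ hmono)
  have hadd : ∀ d, d < n → (i + d) % n = if i % n + d < n then i % n + d else i % n + d - n :=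
      fun d hd => by
    rw [← Nat.mod_add_mod]
    split_ifs with hlt
    · exact Nat.mod_eq_of_lt hlt
    · have := Nat.mod_lt i hn
      rw [Nat.mod_eq_sub_mod (by omega), Nat.mod_eq_of_lt (by omega)]
  obtain ⟨d, rfl⟩ := Nat.exists_eq_add_of_lt hij
  obtain ⟨e, rfl⟩ := Nat.exists_eq_add_of_lt hjk
  have h1 := hadd (d + 1) (by omega)
  have h2 := hadd (d + 1 + e + 1) (by omega)
  have hi := Nat.mod_lt i hn
  rw [show i + (d + 1) = i + d + 1 by omega] at h1
  rw [show i + (d + 1 + e + 1) = i + d + 1 + e + 1 by omega] at h2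
  split_ifs at h1 h2
  · rw [tripleDet_columns]
    exact hsorted _ _ _ (Fin.lt_def.2 (by simp only [residue]; omega))
      (Fin.lt_def.2 (by simp only [residue]; omega))
  · rw [← tripleDet_cyclic, tripleDet_columns]
    exact hsorted _ _ _ (Fin.lt_def.2 (by simp only [residue]; omega))
      (Fin.lt_def.2 (by simp only [residue]; omega))
  · omega
  · rw [tripleDet_cyclic, tripleDet_columns]
    exact hsorted _ _ _ (Fin.lt_def.2 (by simp only [residue]; omega))
      (Fin.lt_def.2 (by simp only [residue]; omega))

end index

/-! ### Boundary points of the totally nonnegative part -/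

theorem minor_ofReal {n : ℕ} (M : Matrix (Fin 3) (Fin n) ℝ) (f : Fin 3 → Fin n) :
    minor (M.map Complex.ofReal) f = Complex.ofReal (minor M f) :=
  minor_map Complex.ofRealHom M f

theorem notMem_GrPos_of_mem_Z {n : ℕ} {𝒜 : Set (Finset (Fin n))} {A : Finset (Fin n)} (hA : A ∈ 𝒜)
    (hcard : 3 ≤ A.card) {W : Submodule ℂ (Fin n → ℂ)} (hW : W ∈ Z 𝒜) : W ∉ GrPos n := by
  rintro ⟨-, M, rfl, hM⟩
  let I := A.orderEmbOfCardLe hcard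
  have h0 := hW.2 A hA I (fun k => A.orderEmbOfCardLe_mem hcard k) _ rfl
  rw [plucker_eq_minor, minor_ofReal, Complex.ofReal_eq_zero] at h0
  exact (hM I).ne' h0

theorem boundary_eq {n : ℕ} (hn : 5 ≤ n) {W : Submodule ℂ (Fin n → ℂ)} (hW : W ∈ GrNonneg n)
    (hpos : W ∉ GrPos n) (hV : W ∈ V n) :
    (∃ A B, IsCyclicPartition A B ∧ W ∈ Z {A, B}) ∨ ∃ i, W ∈ Z (collidingFamily i) := by
  refine or_iff_not_imp_right.2 fun hcol => ?_
  obtain ⟨hGr, M, rfl, hM⟩ := hW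
  have hn' : 0 < n := by omega
  have hreal : ∀ f, minor M f = 0 → minor (M.map Complex.ofReal) f = 0 := fun f hf => by
    rw [minor_ofReal, hf, Complex.ofReal_zero]
  -- Failure of the adjacency condition at some `i` is exactly membership in the second family,
  -- excluded by `hcol`.
  have hconfig : IsCyclicConfig n (columns hn' M) := by
    refine ⟨fun j => ?_, fun i j k => tripleDet_columns_nonneg hn' hM, fun i => ?_⟩
    · ext r
      simp [columns, residue]
    · by_contra! hi
      refine hcol ⟨residue hn' i, (mem_Z_rowSpan hGr).2 ?_⟩
      rintro _ ⟨x, rfl⟩ f hf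
      have h0 : minor M ![residue hn' i, finRotate n (residue hn' i), x] = 0 := by
        rw [finRotate_residue, ← residue_val hn' x, ← tripleDet_columns]
        exact hi x
      have hf' : ∀ k, ∃ l, ![residue hn' i, finRotate n (residue hn' i), x] l = f k := fun k => by
        have := hf k
        simp only [Finset.mem_insert, Finset.mem_singleton] at this
        rcases this with h | h | h
        exacts [⟨0, h.symm⟩, ⟨1, h.symm⟩, ⟨2, h.symm⟩]
      choose l hl using hf'
      rw [← funext hl]
      exact minor_comp_eq_zero (hreal _ h0) l
  obtain ⟨I, hI⟩ : ∃ I, plucker M I = 0 := by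
    by_contra! hne
    exact hpos ⟨hGr, M, rfl, fun I => lt_of_le_of_ne (hM I) (hne I).symm⟩
  rw [plucker_eq_minor, minor_eq_tripleDet hn' fun k => residue_val hn' (I k)] at hI
  have hconic : ∀ a b c d e f, tripleDet (columns hn' M) a b c * tripleDet (columns hn' M) a d e *
        tripleDet (columns hn' M) b d f * tripleDet (columns hn' M) c e f =
      tripleDet (columns hn' M) a b d * tripleDet (columns hn' M) a c e *
        tripleDet (columns hn' M) b c f * tripleDet (columns hn' M) d e f :=
      fun a b c d e f => by
    have := conic_identity_of_mem_V hV (residue hn' a) (residue hn' b) (residue hn' c)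
      (residue hn' d) (residue hn' e) (residue hn' f)
    simp only [minor_ofReal] at this
    simp only [tripleDet_columns]
    exact_mod_cast this
  have hlt : ∀ k l, k < l → (I k : ℕ) < I l := fun k l hkl => I.strictMono hkl
  obtain ⟨i, hi⟩ := hconfig.exists_consecutive (by omega) (hlt 0 1 (by decide))
    (hlt 1 2 (by decide)) ((I 2).2.trans_le (Nat.le_add_left _ _)) hI
  obtain ⟨p, m, h2, hm, hA, hB⟩ := hconfig.exists_two_arcs_of_consecutive hn hconic hi
  refine ⟨_, _, isCyclicPartition_arc hn' (p := p) h2 hm, (mem_Z_rowSpan hGr).2 ?_⟩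
  rintro _ (rfl | rfl) f hf
  · choose y hy hyf using fun k => (mem_arc hn').1 (hf k)
    exact hreal f (by rw [minor_eq_tripleDet hn' hyf, hA _ _ _ (hy 0) (hy 1) (hy 2)])
  · choose y hy hyf using fun k => (mem_arc hn').1 (hf k)
    rw [show p + m + (n - m) = p + n by omega] at hy
    exact hreal f (by rw [minor_eq_tripleDet hn' hyf, hB _ _ _ (hy 0) (hy 1) (hy 2)])

/-- Only a set of at least three indices imposes a condition; such a set keeps the points of Z(A|B)
out of `GrPos n`. -/
theorem exists_three_le_card_of_isCyclicPartition {n : ℕ} (hn : 5 ≤ n) {A B : Finset (Fin n)}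
    (h : IsCyclicPartition A B) : ∃ C ∈ ({A, B} : Set (Finset (Fin n))), 3 ≤ C.card := by
  have hc := Finset.card_union_of_disjoint h.2.2.1
  rw [h.2.2.2.1, Finset.card_univ, Fintype.card_fin] at hc
  rcases Nat.lt_or_ge A.card 3 with h3 | h3
  · exact ⟨B, by simp, by omega⟩
  · exact ⟨A, by simp, h3⟩

theorem exists_three_le_card_collidingFamily {n : ℕ} (hn : 5 ≤ n) (i : Fin n) :
    ∃ C ∈ collidingFamily i, 3 ≤ C.card := by
  have hne : i ≠ finRotate n i := by
    obtain ⟨m, rfl⟩ := Nat.exists_eq_add_one.2 (show 0 < n by omega)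
    rw [finRotate_apply]
    intro h
    have := congrArg Fin.val (left_eq_add.1 h)
    simp at this
    omega
  obtain ⟨x, hx⟩ : ∃ x, x ∉ ({i, finRotate n i} : Finset (Fin n)) := by
    by_contra! hall
    have h1 := Finset.card_le_card fun x (_ : x ∈ Finset.univ) => hall x
    rw [Finset.card_univ, Fintype.card_fin] at h1
    have := h1.trans Finset.card_le_two
    omega
  simp only [Finset.mem_insert, Finset.mem_singleton, not_or] at hx
  exact ⟨_, ⟨x, rfl⟩, (Finset.card_eq_three.2
    ⟨i, finRotate n i, x, hne, Ne.symm hx.1, Ne.symm hx.2, rfl⟩).ge⟩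

end ABCT

end

theorem theorem5p9 (n : ℕ) (hn : 5 ≤ n) :
    (ABCT.GrNonneg n \ ABCT.GrPos n) ∩ ABCT.V n =
      (⋃ (A : Finset (Fin n)) (B : Finset (Fin n)) (_ : ABCT.IsCyclicPartition A B),
        ABCT.nonnegPart (ABCT.Z {A, B})) ∪
      (⋃ i : Fin n, ABCT.nonnegPart (ABCT.ZV (ABCT.collidingFamily i))) ∧
    ∀ A B : Finset (Fin n), ABCT.IsCyclicPartition A B →
      (ABCT.Z {A, B} ⊆ ABCT.V n ∧ ABCT.Z {A, B} = ABCT.ZV {A, B}) ∧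
      ∀ J : Fin 3 ↪o Fin n,
        ABCT.idealV J ≤ ABCT.idealZ {A, B} J ∧
        ABCT.idealZ {A, B} J = ABCT.idealZV {A, B} J := by
  refine ⟨Set.Subset.antisymm ?_ ?_, fun A B hAB => ?_⟩
  · rintro W ⟨⟨hW, hpos⟩, hV⟩
    rcases ABCT.boundary_eq hn hW hpos hV with ⟨A, B, hAB, hZ⟩ | ⟨i, hZ⟩
    · refine Or.inl ?_
      simp only [Set.mem_iUnion]
      exact ⟨A, B, hAB, hZ, hW⟩
    · exact Or.inr (Set.mem_iUnion.2 ⟨i, ⟨hZ, hV⟩, hW⟩)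
  · rintro W (hW | hW)
    · simp only [Set.mem_iUnion] at hW
      obtain ⟨A, B, hAB, hZ, hW⟩ := hW
      obtain ⟨C, hC, hcard⟩ := ABCT.exists_three_le_card_of_isCyclicPartition hn hAB
      exact ⟨⟨hW, ABCT.notMem_GrPos_of_mem_Z hC hcard hZ⟩, ABCT.Z_subset_V hAB.2.2.2.1 hZ⟩
    · obtain ⟨i, ⟨hZ, hV⟩, hW⟩ := Set.mem_iUnion.1 hW
      obtain ⟨C, hC, hcard⟩ := ABCT.exists_three_le_card_collidingFamily hn i
      exact ⟨⟨hW, ABCT.notMem_GrPos_of_mem_Z hC hcard hZ⟩, hV⟩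
  · have hV : ABCT.Z {A, B} ⊆ ABCT.V n := ABCT.Z_subset_V hAB.2.2.2.1
    refine ⟨⟨hV, (Set.inter_eq_left.2 hV).symm⟩, fun J => ?_⟩
    have hle := ABCT.idealV_le_idealZ hAB.2.2.2.1 hAB.2.2.1 J
    exact ⟨hle, (sup_eq_left.2 hle).symm⟩
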